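/- Let $d\ge 1$ and $m\ge 1$ be integers and $K>0$. For an integer $k\ge 0$ let $H^k$ be the Sobolev space of $u\in L_2(\mathbb R^d)$ whose weak derivatives $\partial^\alpha u$, $|\alpha|\le k$, belong to $L_2(\mathbb R^d)$, with $\|u\|_k^2=\sum_{|\alpha|\le k}\|\partial^\alpha u\|_0^2$, where $\|\cdot\|_0$ and $(\cdot,\cdot)_0$ are the norm and inner product of $L_2(\mathbb R^d)$. There is a constant $N$, depending only on $K$, $d$ and $m$, with the following property. Let $(Z,\mathcal Z,\mu)$ be a measure space, $\bar c\in L_2(Z,\mu)$, and let $c:\mathbb R^d\times Z\to\mathbb R^d$ be jointly measurable, $m+1$ times continuously differentiable in $x$, and such that $$|\partial^\alpha c(x,z)|\le \bar c(z)\wedge K\quad(|\alpha|\le m+1),\qquad K^{-1}\le|\det(\mathbb I+\theta Dc(x,z))|$$ for all $x\in\mathbb R^d$, $z\in Z$, $\theta\in[0,1]$, where derivatives are in $x$ and $Dc$ is the Jacobian in $x$. Then for every $u\in H^{m+2}$ and every multi-index $\alpha$ with $|\alpha|\le m$, all derivatives and integrals in $$\mathscr G^\alpha(u)=\int_Z\big\|\partial^\alpha\big(u(\cdot+c(\cdot,z))-u\big)\big\|_0^2\,\mu(dz)+2\Big(\int_Z\partial^\alpha\big(u(\cdot+c(\cdot,z))-u-c(\cdot,z)\cdot\nabla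 u\big)\,\mu(dz),\ \partial^\alpha u\Big)_0$$ exist (the derivatives are weak derivatives in $L_2(\mathbb R^d)$; the first integral over $Z$ is finite and the second one is a Bochner integral in $L_2(\mathbb R^d)$), and $$\mathscr G^\alpha(u)\le N\Big(\int_Z\bar c(z)^2\,\mu(dz)\Big)\|u\|_m^2 .$$ -/

import Mathlib

open MeasureTheory
open scoped ContDiff

noncomputable section

/-- The `i`-th classical partial derivative of a function on `ℝ^d`. -/
def partialD {d : ℕ} {F : Type*} [NormedAddCommGroup F] [NormedSpace ℝ F] (i : Fin d)
    (f : EuclideanSpace ℝ (Fin d) → F) : EuclideanSpace ℝ (Fin d) → F :=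
  fun x => fderiv ℝ f x (EuclideanSpace.single i 1)

/-- The classical derivative `∂^α f = ∂_1^{α_1} ⋯ ∂_d^{α_d} f` for a multi-index `α`. -/
def multiD {d : ℕ} {F : Type*} [NormedAddCommGroup F] [NormedSpace ℝ F] (α : Fin d → ℕ)
    (f : EuclideanSpace ℝ (Fin d) → F) : EuclideanSpace ℝ (Fin d) → F :=
  (List.finRange d).foldr (fun i g => (partialD i)^[α i] g) f

/-- `v ∈ L_2(ℝ^d)` is the weak (distributional) derivative `∂^α u` of the locally integrable
function `u`. -/
def IsWeakDeriv {d : ℕ} (α : Fin d → ℕ) (u : EuclideanSpace ℝ (Fin d) → ℝ)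
    (v : Lp ℝ 2 (volume : Measure (EuclideanSpace ℝ (Fin d)))) : Prop :=
  LocallyIntegrable u ∧
    ∀ φ : EuclideanSpace ℝ (Fin d) → ℝ, ContDiff ℝ ∞ φ → HasCompactSupport φ →
      ∫ x, u x * multiD α φ x = (-1) ^ (∑ i, α i) * ∫ x, v x * φ x

/-- `u` has a weak derivative `∂^α u` in `L_2(ℝ^d)`. -/
def HasWeakDeriv {d : ℕ} (α : Fin d → ℕ) (u : EuclideanSpace ℝ (Fin d) → ℝ) : Prop :=
  ∃ v : Lp ℝ 2 (volume : Measure (EuclideanSpace ℝ (Fin d))), IsWeakDeriv α u v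

/-- A weak derivative in `L_2` is unique. -/
theorem IsWeakDeriv.unique {d : ℕ} {α : Fin d → ℕ} {u : EuclideanSpace ℝ (Fin d) → ℝ}
    {v w : Lp ℝ 2 (volume : Measure (EuclideanSpace ℝ (Fin d)))}
    (hv : IsWeakDeriv α u v) (hw : IsWeakDeriv α u w) : v = w := by
  refine Lp.ext (ae_eq_of_integral_contDiff_smul_eq
    ((Lp.memLp v).locallyIntegrable (by norm_num))
    ((Lp.memLp w).locallyIntegrable (by norm_num)) fun φ hφ hc => ?_)
  have h := (hv.2 φ hφ hc).symm.trans (hw.2 φ hφ hc)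
  have h2 := mul_left_cancel₀ (pow_ne_zero _ (by norm_num)) h
  simpa [smul_eq_mul, mul_comm] using h2

open Classical in
/-- The weak derivative `∂^α u` as an element of `L_2(ℝ^d)`
(with the value `0` if there is none). -/
def weakDeriv {d : ℕ} (α : Fin d → ℕ) (u : EuclideanSpace ℝ (Fin d) → ℝ) :
    Lp ℝ 2 (volume : Measure (EuclideanSpace ℝ (Fin d))) :=
  if h : HasWeakDeriv α u then h.choose else 0

theorem IsWeakDeriv.weakDeriv_eq {d : ℕ} {α : Fin d → ℕ} {u : EuclideanSpace ℝ (Fin d) → ℝ}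
    {v : Lp ℝ 2 (volume : Measure (EuclideanSpace ℝ (Fin d)))}
    (hv : IsWeakDeriv α u v) : weakDeriv α u = v := by
  have h : HasWeakDeriv α u := ⟨v, hv⟩
  rw [weakDeriv, dif_pos h]
  exact h.choose_spec.unique hv

/-- `u ∈ H^k`: `u ∈ L_2(ℝ^d)` and all weak derivatives of order at most `k` are in
`L_2(ℝ^d)`. -/
def MemH {d : ℕ} (k : ℕ) (u : EuclideanSpace ℝ (Fin d) → ℝ) : Prop :=
  MemLp u 2 volume ∧ ∀ α : Fin d → ℕ, ∑ i, α i ≤ k → HasWeakDeriv α u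

/-- The Sobolev norm `‖u‖_k = (∑_{|α| ≤ k} ‖∂^α u‖_0^2)^{1/2}`. -/
def normH {d : ℕ} (k : ℕ) (u : EuclideanSpace ℝ (Fin d) → ℝ) : ℝ :=
  Real.sqrt (∑ α ∈ (Fintype.piFinset fun _ : Fin d => Finset.range (k + 1)) with ∑ i, α i ≤ k,
    ‖weakDeriv α u‖ ^ 2)

/-- The regularity and nondegeneracy assumption on the jump coefficient `c`, with order `m`,
constant `K` and dominating function `cbar`. -/
structure JumpAssumption {d : ℕ} {Z : Type*} [MeasurableSpace Z] (μ : Measure Z) (m : ℕ) (K : ℝ)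
    (c : EuclideanSpace ℝ (Fin d) → Z → EuclideanSpace ℝ (Fin d)) (cbar : Z → ℝ) : Prop where
  measurable : Measurable fun p : EuclideanSpace ℝ (Fin d) × Z => c p.1 p.2
  memLp_cbar : MemLp cbar 2 μ
  contDiff : ∀ z, ContDiff ℝ ((m + 1 : ℕ) : ℕ∞ω) fun x => c x z
  norm_multiD_le : ∀ α : Fin d → ℕ, ∑ i, α i ≤ m + 1 → ∀ x z,
    ‖multiD α (fun y => c y z) x‖ ≤ min (cbar z) K
  le_abs_det : ∀ x z, ∀ θ ∈ Set.Icc (0 : ℝ) 1,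
    K⁻¹ ≤ |(ContinuousLinearMap.id ℝ (EuclideanSpace ℝ (Fin d))
      + θ • fderiv ℝ (fun y => c y z) x).det|

/-- The increment `x ↦ u(x + c(x,z)) - u(x)`. -/
def jumpDiff {d : ℕ} {Z : Type*} (c : EuclideanSpace ℝ (Fin d) → Z → EuclideanSpace ℝ (Fin d))
    (u : EuclideanSpace ℝ (Fin d) → ℝ) (z : Z) : EuclideanSpace ℝ (Fin d) → ℝ :=
  fun x => u (x + c x z) - u x

/-- The compensated increment `x ↦ u(x + c(x,z)) - u(x) - c(x,z) · ∇u(x)`, where `∇u` is the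
weak gradient. -/
def jumpRem {d : ℕ} {Z : Type*} (c : EuclideanSpace ℝ (Fin d) → Z → EuclideanSpace ℝ (Fin d))
    (u : EuclideanSpace ℝ (Fin d) → ℝ) (z : Z) : EuclideanSpace ℝ (Fin d) → ℝ :=
  fun x => u (x + c x z) - u x - ∑ i, c x z i * weakDeriv (Pi.single i 1) u x

/-- `𝒢^α(u) = ∫_Z ‖∂^α(u(·+c) - u)‖_0^2 μ(dz)
  + 2 (∫_Z ∂^α(u(·+c) - u - c·∇u) μ(dz), ∂^α u)_0`;
the second integral over `Z` is the Bochner integral in `L_2(ℝ^d)`. -/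
def jumpG {d : ℕ} {Z : Type*} [MeasurableSpace Z] (μ : Measure Z)
    (c : EuclideanSpace ℝ (Fin d) → Z → EuclideanSpace ℝ (Fin d))
    (α : Fin d → ℕ) (u : EuclideanSpace ℝ (Fin d) → ℝ) : ℝ :=
  (∫ z, ‖weakDeriv α (jumpDiff c u z)‖ ^ 2 ∂μ)
    + 2 * inner ℝ (∫ z, weakDeriv α (jumpRem c u z) ∂μ) (weakDeriv α u)

/-- All the derivatives and integrals in the definition of `𝒢^α(u)` exist. -/
def JumpGWellDefined {d : ℕ} {Z : Type*} [MeasurableSpace Z] (μ : Measure Z)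
    (c : EuclideanSpace ℝ (Fin d) → Z → EuclideanSpace ℝ (Fin d))
    (α : Fin d → ℕ) (u : EuclideanSpace ℝ (Fin d) → ℝ) : Prop :=
  (∀ z, HasWeakDeriv α (jumpDiff c u z)) ∧
  (∀ z, HasWeakDeriv α (jumpRem c u z)) ∧
  Integrable (fun z => ‖weakDeriv α (jumpDiff c u z)‖ ^ 2) μ ∧
  Integrable (fun z => weakDeriv α (jumpRem c u z)) μ

end

/-!
For a fixed `z` write `c = c(·, z)`, `κ = min (cbar z) K`, `T u = u(· + c)` and `v = ∂^α u`.
The integrand of `𝒢^α(u)` is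

  `‖∂^α (T u) - v‖^2 + 2 (∂^α (T u) - v - ∂^α (c · ∇u), v)_0
    = ‖∂^α (T u)‖^2 - ‖v‖^2 - 2 (∂^α (c · ∇u), v)_0`,

and it has to be bounded by a constant times `κ^2 ‖u‖_m^2`. Expanding the derivatives gives

  `∂^α (T u) = T v + X + R`,   `∂^α (c · ∇u) = c · ∇v + Y`,

where `Y = ∑ b ∂^β u` with `|β| ≤ |α|` and coefficients `b` that are derivatives of `c`, hence
`O(κ)` with bounded derivatives, `X = ∑ b T ∂^β u` has the same coefficients, and `R` collects the
terms whose coefficients contain at least two factors from `c`, so that `R = O(κ^2)`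
(`exists_expansion`). All terms of first order in `κ` then cancel:

* `‖T v‖^2 - ‖v‖^2 = - ((div c) v, v)_0 + O(κ^2)`, by the change of variables `y = x + c(x)` and the
  expansion of the Jacobian determinant (`exists_norm_compOp_sq_bound`), whereas
  `2 (c · ∇v, v)_0 = - ((div c) v, v)_0` by integration by parts;
* `(T v, X)_0 - (v, Y)_0 = O(κ^2)`, by the same change of variables
  (`exists_inner_mulOp_compOp_bound`).

The change of variables requires that `x ↦ x + c(x)` be a bijection. This is obtained by
continuation in `θ ∈ [0,1]` along `x ↦ x + θ c(x)`: the bounds on `Dc` and on the determinant make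
the inverses of these maps uniformly Lipschitz, so that injectivity persists under steps of a fixed
size in `θ` (`JumpField.bijective`).

Calculus with weak derivatives (product rule, chain rule, integration by parts) reduces to the
classical one by mollification: a function in `H^1` is the limit of functions with a `C^1`
representative (`gradient_induction`). The existence of the integrals over `Z` follows from
`‖T f - f‖ = O(κ)` for `f ∈ H^1` and `‖T f - f - c · ∇f‖ = O(κ^2)` for `f ∈ H^2`, and from the
strong measurability in `z` of the weak derivatives, which holds since they are weakly measurable
and `L_2(ℝ^d)` is separable.
-/

open scoped Topology ENNReal Convolution

local notation:max "𝕍" n:max => EuclideanSpace ℝ (Fin n)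

/-! ### Partial derivatives along words and multi-indices -/

section Words

variable {d : ℕ} {F : Type*} [NormedAddCommGroup F] [NormedSpace ℝ F]

theorem partialD_contDiff {n : ℕ∞ω} {i : Fin d} {f : 𝕍 d → F}
    (hf : ContDiff ℝ (n + 1) f) : ContDiff ℝ n (partialD i f) :=
  (hf.fderiv_right le_rfl).clm_apply contDiff_const

theorem partialD_comm {i j : Fin d} {f : 𝕍 d → F} (hf : ContDiff ℝ 2 f) :
    partialD i (partialD j f) = partialD j (partialD i f) := by
  have hd : Differentiable ℝ (fderiv ℝ f) :=
    (hf.fderiv_right (m := 1) (by norm_num)).differentiable (by norm_num)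
  have key : ∀ (k l : Fin d) x, partialD k (partialD l f) x
      = fderiv ℝ (fderiv ℝ f) x (EuclideanSpace.single k 1) (EuclideanSpace.single l 1) := by
    intro k l x
    unfold partialD
    rw [fderiv_clm_apply (hd x) (differentiableAt_const _)]
    simp
  funext x
  rw [key, key]
  exact (hf.contDiffAt.isSymmSndFDerivAt (by simp)) _ _

/-- The iterated partial derivative along a word, the last letter acting first. -/
noncomputable def wordD (l : List (Fin d)) (f : 𝕍 d → F) : 𝕍 d → F :=
  l.foldr partialD f

theorem wordD_contDiff {n : ℕ∞ω} (l : List (Fin d)) {f : 𝕍 d → F}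
    (hf : ContDiff ℝ (n + l.length) f) : ContDiff ℝ n (wordD l f) := by
  induction l generalizing n with
  | nil => simpa [wordD] using hf
  | cons i l ih =>
    refine partialD_contDiff (ih ?_)
    have : n + ((i :: l).length : ℕ∞ω) = n + 1 + (l.length : ℕ∞ω) := by
      rw [List.length_cons]; push_cast; rw [add_assoc, add_comm (1 : ℕ∞ω)]
    rwa [← this]

/-- On sufficiently smooth functions the order of the letters is immaterial. -/
theorem wordD_perm {l l' : List (Fin d)} (h : l.Perm l') {f : 𝕍 d → F}
    (hf : ContDiff ℝ l.length f) : wordD l f = wordD l' f := by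
  induction h with
  | nil => rfl
  | cons a _ ih =>
    have := ih (hf.of_le (by simp))
    simp only [wordD, List.foldr_cons] at this ⊢
    rw [this]
  | swap a b l =>
    simp only [wordD, List.foldr_cons]
    refine partialD_comm (wordD_contDiff l ?_)
    have : (2 : ℕ∞ω) + (l.length : ℕ∞ω) = (((b :: a :: l).length : ℕ) : ℕ∞ω) := by
      simp only [List.length_cons]; push_cast; rw [add_comm, add_assoc]; norm_num
    rwa [this]
  | trans h₁ _ ih₁ ih₂ => exact (ih₁ hf).trans (ih₂ (h₁.length_eq ▸ hf))

/-- The sorted word in which each letter `i` occurs `α i` times. -/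
def multiWord (α : Fin d → ℕ) : List (Fin d) :=
  (List.finRange d).flatMap fun i => List.replicate (α i) i

theorem multiD_eq_wordD (α : Fin d → ℕ) (f : 𝕍 d → F) :
    multiD α f = wordD (multiWord α) f := by
  unfold multiD wordD multiWord
  induction List.finRange d with
  | nil => rfl
  | cons a l ih =>
    rw [List.flatMap_cons, List.foldr_append, ← ih, List.foldr_cons]
    generalize l.foldr (fun i g => (partialD i)^[α i] g) f = g
    induction α a with
    | zero => rfl
    | succ n ih' => rw [Function.iterate_succ_apply', ih', List.replicate_succ, List.foldr_cons]

theorem count_multiWord (α : Fin d → ℕ) (i : Fin d) : (multiWord α).count i = α i := by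
  rw [multiWord, List.count_flatMap]
  simp only [Function.comp_def, List.count_replicate]
  rw [← List.ofFn_eq_map, List.sum_ofFn]
  simp

theorem length_multiWord (α : Fin d → ℕ) : (multiWord α).length = ∑ i, α i := by
  rw [multiWord, List.length_flatMap]
  simp only [List.length_replicate]
  rw [← List.ofFn_eq_map, List.sum_ofFn]

theorem sum_add_single (α : Fin d → ℕ) (i : Fin d) :
    ∑ j, (α + Pi.single i 1 : Fin d → ℕ) j = ∑ j, α j + 1 := by
  simp [Finset.sum_add_distrib]

/-- `∂^{α + e_i} = ∂_i ∂^α` on functions of class `C^{|α| + 1}`. -/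
theorem multiD_add_single (α : Fin d → ℕ) (i : Fin d) {f : 𝕍 d → F}
    (hf : ContDiff ℝ ((∑ j, α j + 1 : ℕ) : ℕ∞ω) f) :
    multiD (α + Pi.single i 1) f = partialD i (multiD α f) := by
  rw [multiD_eq_wordD, multiD_eq_wordD]
  change _ = wordD (i :: multiWord α) f
  refine wordD_perm ?_ (by rwa [length_multiWord, sum_add_single])
  rw [List.perm_iff_count]
  intro a
  rw [count_multiWord, List.count_cons, count_multiWord]
  by_cases h : a = i
  · subst h; simp
  · simp [h, Ne.symm h]

theorem multiD_contDiff {n : ℕ∞ω} (α : Fin d → ℕ) {f : 𝕍 d → F}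
    (hf : ContDiff ℝ (n + (∑ j, α j : ℕ)) f) : ContDiff ℝ n (multiD α f) := by
  rw [multiD_eq_wordD]
  exact wordD_contDiff _ (by rwa [length_multiWord])

theorem multiD_zero (f : 𝕍 d → F) : multiD 0 f = f := by
  rw [multiD_eq_wordD,
    List.eq_nil_of_length_eq_zero (l := multiWord 0) (by simp [length_multiWord])]
  rfl

theorem multiD_smooth (α : Fin d → ℕ) {f : 𝕍 d → F}
    (hf : ContDiff ℝ ∞ f) : ContDiff ℝ ∞ (multiD α f) := by
  refine multiD_contDiff α (hf.of_le ?_)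
  exact_mod_cast le_top

theorem partialD_smooth (i : Fin d) {f : 𝕍 d → F}
    (hf : ContDiff ℝ ∞ f) : ContDiff ℝ ∞ (partialD i f) :=
  partialD_contDiff (by simpa using hf)

theorem partialD_hasCompactSupport (i : Fin d) {f : 𝕍 d → F}
    (hf : HasCompactSupport f) : HasCompactSupport (partialD i f) :=
  hf.fderiv_apply ℝ _

theorem multiD_hasCompactSupport (α : Fin d → ℕ) {f : 𝕍 d → F}
    (hf : HasCompactSupport f) : HasCompactSupport (multiD α f) := by
  rw [multiD_eq_wordD]
  induction multiWord α with
  | nil => exact hf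
  | cons i l ih => exact partialD_hasCompactSupport i ih

/-- Every nonzero multi-index is `α + e_i` for some `α` of order one less. -/
theorem exists_eq_add_single {n : ℕ} {α : Fin d → ℕ} (h : ∑ j, α j = n + 1) :
    ∃ (β : Fin d → ℕ) (i : Fin d), α = β + Pi.single i 1 ∧ ∑ j, β j = n := by
  obtain ⟨i, hi⟩ : ∃ i, α i ≠ 0 := by
    by_contra! h0
    simp [h0] at h
  have e : α = Function.update α i (α i - 1) + Pi.single i 1 := by
    funext j
    by_cases hj : j = i
    · subst hj; simp; omega
    · simp [hj]
  refine ⟨Function.update α i (α i - 1), i, e, ?_⟩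
  have := sum_add_single (Function.update α i (α i - 1)) i
  rw [← e] at this
  omega

/-- Partial derivatives act on the components of a vector field separately. -/
theorem multiD_component (α : Fin d → ℕ) {e : ℕ}
    {c : 𝕍 d → 𝕍 e} (j : Fin e)
    (hc : ContDiff ℝ (∑ i, α i : ℕ) c) (x : 𝕍 d) :
    multiD α (fun y => c y j) x = multiD α c x j := by
  rw [multiD_eq_wordD, multiD_eq_wordD]
  rw [← length_multiWord] at hc
  revert hc x
  induction multiWord α with
  | nil => intro _ x; rfl
  | cons i l ih =>
    intro hc x
    have ih' : wordD l (fun y => c y j) = fun x => wordD l c x j := by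
      funext x; exact ih (hc.of_le (by simp)) x
    change partialD i (wordD l _) x = partialD i (wordD l c) x j
    rw [ih']
    have hd : DifferentiableAt ℝ (wordD l c) x :=
      ((wordD_contDiff (n := 1) l (by
        rw [List.length_cons] at hc; push_cast at hc; rwa [add_comm])).differentiable
          (by norm_num)) x
    unfold partialD
    have := (EuclideanSpace.proj (𝕜 := ℝ) j : 𝕍 e →L[ℝ] ℝ).hasFDerivAt.comp x hd.hasFDerivAt
    have h2 : (⇑(EuclideanSpace.proj (𝕜 := ℝ) j : 𝕍 e →L[ℝ] ℝ) ∘ wordD l c)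
        = fun x => wordD l c x j := rfl
    rw [h2] at this
    rw [this.fderiv]
    simp

end Words

/-! ### Functions with bounded derivatives -/

section DerivBound

variable {d : ℕ}

/-- `b` is of class `C^k` and all its partial derivatives of order at most `k` are bounded by
`M`. -/
def DerivBound : ℕ → ℝ → (𝕍 d → ℝ) → Prop
  | 0, M, b => Continuous b ∧ ∀ x, |b x| ≤ M
  | k + 1, M, b => ContDiff ℝ 1 b ∧ (∀ x, |b x| ≤ M) ∧ ∀ i, DerivBound k M (partialD i b)

variable {k : ℕ} {M M' : ℝ} {b b' : 𝕍 d → ℝ}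

theorem DerivBound.continuous (h : DerivBound k M b) : Continuous b := by
  cases k with
  | zero => exact h.1
  | succ k => exact h.1.continuous

theorem DerivBound.abs_le (h : DerivBound k M b) (x : 𝕍 d) : |b x| ≤ M := by
  cases k with
  | zero => exact h.2 x
  | succ k => exact h.2.1 x

theorem DerivBound.nonneg (h : DerivBound k M b) : 0 ≤ M := (abs_nonneg _).trans (h.abs_le 0)

theorem DerivBound.of_succ (h : DerivBound (k + 1) M b) : DerivBound k M b := by
  induction k generalizing b with
  | zero => exact ⟨h.1.continuous, h.2.1⟩
  | succ k ih => exact ⟨h.1, h.2.1, fun i => ih (h.2.2 i)⟩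

theorem DerivBound.of_le {l : ℕ} (h : DerivBound k M b) (hl : l ≤ k) : DerivBound l M b := by
  induction k, hl using Nat.le_induction with
  | base => exact h
  | succ n _ ih => exact ih h.of_succ

theorem DerivBound.add (h : DerivBound k M b) (h' : DerivBound k M' b') :
    DerivBound k (M + M') (fun x => b x + b' x) := by
  induction k generalizing b b' with
  | zero =>
    exact ⟨h.1.add h'.1, fun x => (abs_add_le _ _).trans (add_le_add (h.2 x) (h'.2 x))⟩
  | succ k ih =>
    refine ⟨h.1.add h'.1, fun x => (abs_add_le _ _).trans (add_le_add (h.2.1 x) (h'.2.1 x)),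
      fun i => ?_⟩
    have : partialD i (fun x => b x + b' x) = fun x => partialD i b x + partialD i b' x := by
      funext x
      unfold partialD
      rw [fderiv_fun_add (h.1.differentiable one_ne_zero x) (h'.1.differentiable one_ne_zero x)]
      rfl
    rw [this]
    exact ih (h.2.2 i) (h'.2.2 i)

theorem partialD_mul {i : Fin d} (h : ContDiff ℝ 1 b) (h' : ContDiff ℝ 1 b')
    (x : 𝕍 d) :
    partialD i (fun x => b x * b' x) x = partialD i b x * b' x + b x * partialD i b' x := by
  unfold partialD
  rw [fderiv_fun_mul (h.differentiable one_ne_zero x) (h'.differentiable one_ne_zero x)]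
  simp only [add_apply, smul_apply, smul_eq_mul]
  ring

/-- The factor `2 ^ k` is the sum of the binomial coefficients in the Leibniz rule. -/
theorem DerivBound.mul (h : DerivBound k M b) (h' : DerivBound k M' b') :
    DerivBound k (2 ^ k * (M * M')) (fun x => b x * b' x) := by
  have hb : ∀ x, |b x * b' x| ≤ M * M' := fun x => by
    rw [abs_mul]; exact mul_le_mul (h.abs_le x) (h'.abs_le x) (abs_nonneg _) h.nonneg
  have h0 : 0 ≤ M * M' := mul_nonneg h.nonneg h'.nonneg
  induction k generalizing b b' with
  | zero => exact ⟨h.1.mul h'.1, by simpa using hb⟩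
  | succ k ih =>
    refine ⟨h.1.mul h'.1, fun x => (hb x).trans (le_mul_of_one_le_left h0 (one_le_pow₀ one_le_two)),
      fun i => ?_⟩
    have : partialD i (fun x => b x * b' x)
        = fun x => partialD i b x * b' x + b x * partialD i b' x :=
      funext fun x => partialD_mul h.1 h'.1 x
    rw [this, show (2 : ℝ) ^ (k + 1) * (M * M') = 2 ^ k * (M * M') + 2 ^ k * (M * M') by ring]
    refine (ih (h.2.2 i) h'.of_succ fun x => ?_).add (ih h.of_succ (h'.2.2 i) fun x => ?_)
    · rw [abs_mul]
      exact mul_le_mul ((h.2.2 i).abs_le x) (h'.abs_le x) (abs_nonneg _) h.nonneg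
    · rw [abs_mul]
      exact mul_le_mul (h.abs_le x) ((h'.2.2 i).abs_le x) (abs_nonneg _) h.nonneg

theorem DerivBound.const_mul (h : DerivBound k M b) {t : ℝ} (ht : |t| ≤ 1) :
    DerivBound k M (fun x => t * b x) := by
  have hb : ∀ y : ℝ, |y| ≤ M → |t * y| ≤ M := fun y hy => by
    rw [abs_mul]; nlinarith [abs_nonneg y, abs_nonneg t]
  induction k generalizing b with
  | zero => exact ⟨continuous_const.mul h.1, fun x => hb _ (h.2 x)⟩
  | succ k ih =>
    refine ⟨contDiff_const.mul h.1, fun x => hb _ (h.2.1 x), fun i => ?_⟩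
    have : partialD i (fun x => t * b x) = fun x => t * partialD i b x := by
      funext x
      unfold partialD
      rw [fderiv_const_mul (h.1.differentiable one_ne_zero x)]
      rfl
    rw [this]
    exact ih (h.2.2 i)

/-- A function whose derivatives `∂^α b` with `|α| ≤ k` are bounded by `M` satisfies
`DerivBound k M b`. -/
theorem derivBound_of_multiD (hb : ContDiff ℝ k b)
    (h : ∀ α : Fin d → ℕ, ∑ i, α i ≤ k → ∀ x, |multiD α b x| ≤ M) : DerivBound k M b := by
  suffices H : ∀ (n : ℕ) (α : Fin d → ℕ), ∑ i, α i + n ≤ k → DerivBound n M (multiD α b) by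
    simpa [multiD_zero] using H k 0 (by simp)
  intro n
  induction n with
  | zero =>
    intro α hα
    exact ⟨(multiD_contDiff (n := 0) α (hb.of_le (by
      rw [zero_add]; exact_mod_cast (by omega : ∑ i, α i ≤ k)))).continuous, h α (by omega)⟩
  | succ n ih =>
    intro α hα
    refine ⟨multiD_contDiff (n := 1) α (hb.of_le ?_), h α (by omega), fun i => ?_⟩
    · exact_mod_cast (by omega : 1 + ∑ i, α i ≤ k)
    · rw [← multiD_add_single α i (hb.of_le (by exact_mod_cast (by omega : ∑ i, α i + 1 ≤ k)))]
      exact ih _ (by rw [sum_add_single]; omega)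

end DerivBound

/-! ### Weak partial derivatives in `L_2` and approximation by smooth functions -/

/-- The space `L_2(ℝ^d)`. -/
noncomputable abbrev L2 (d : ℕ) := Lp ℝ 2 (volume : Measure (𝕍 d))

theorem eLpNorm_two_sq {α : Type*} [MeasurableSpace α] {E : Type*} [NormedAddCommGroup E]
    (f : α → E) (μ : Measure α) : eLpNorm f 2 μ ^ 2 = ∫⁻ x, ‖f x‖ₑ ^ 2 ∂μ := by
  have := eLpNorm_nnreal_pow_eq_lintegral (f := f) (μ := μ) (p := 2) (by norm_num)
  simpa using this

/-- Jensen's inequality for the square and a probability measure. -/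
theorem enorm_integral_sq_le {α : Type*} [MeasurableSpace α] {μ : Measure α}
    [IsProbabilityMeasure μ] {h : α → ℝ} (hh : AEStronglyMeasurable h μ) :
    ‖∫ x, h x ∂μ‖ₑ ^ 2 ≤ ∫⁻ x, ‖h x‖ₑ ^ 2 ∂μ := by
  rw [← eLpNorm_two_sq]
  gcongr
  refine (enorm_integral_le_lintegral_enorm h).trans ?_
  rw [← eLpNorm_one_eq_lintegral_enorm]
  exact eLpNorm_le_eLpNorm_of_exponent_le (by norm_num) hh

section Mollify

variable {d : ℕ}

theorem L2_locallyIntegrable (f : L2 d) : LocallyIntegrable f volume :=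
  (Lp.memLp f).locallyIntegrable (by norm_num)

/-- The mollification of `f`. -/
noncomputable def mollify (ψ : ContDiffBump (0 : 𝕍 d)) (f : 𝕍 d → ℝ) : 𝕍 d → ℝ :=
  ψ.normed volume ⋆[ContinuousLinearMap.lsmul ℝ ℝ, volume] f

theorem mollify_contDiff (ψ : ContDiffBump (0 : 𝕍 d)) (f : L2 d) : ContDiff ℝ ∞ (mollify ψ f) :=
  ψ.hasCompactSupport_normed.contDiff_convolution_left _ ψ.contDiff_normed (L2_locallyIntegrable f)

/-- By Jensen's inequality, mollification moves `f` in `L_2` by at most as much as the translations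
over which it averages do. -/
theorem eLpNorm_mollify_sub_le (ψ : ContDiffBump (0 : 𝕍 d)) (f : L2 d) (ε : ℝ≥0∞)
    (h : ∀ y, ‖y‖ < ψ.rOut → eLpNorm (fun x => f (x - y) - f x) 2 volume ≤ ε) :
    eLpNorm (fun x => mollify ψ f x - f x) 2 volume ≤ ε := by
  set ρ : 𝕍 d → ℝ := ψ.normed volume with hρ
  have hρc : Continuous ρ := ψ.contDiff_normed.continuous (n := 0)
  have hρ0 : ∀ x, 0 ≤ ρ x := ψ.nonneg_normed
  have hρi : ∫ x, ρ x = 1 := ψ.integral_normed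
  have hρint : Integrable ρ := hρc.integrable_of_hasCompactSupport ψ.hasCompactSupport_normed
  have hlρ : ∫⁻ x, ENNReal.ofReal (ρ x) = 1 := by
    rw [← ofReal_integral_eq_lintegral_ofReal hρint (ae_of_all _ hρ0), hρi, ENNReal.ofReal_one]
  let ν : Measure (𝕍 d) := volume.withDensity fun x => ENNReal.ofReal (ρ x)
  have hρm : Measurable fun x => ENNReal.ofReal (ρ x) := hρc.measurable.ennreal_ofReal
  have : IsProbabilityMeasure ν := ⟨by
    rw [withDensity_apply _ MeasurableSet.univ, Measure.restrict_univ, hlρ]⟩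
  have hfm : Measurable f := (Lp.stronglyMeasurable f).measurable
  -- `ν` has total mass one, so `f x` is the average of the constant `f x`.
  have key : ∀ x, ‖mollify ψ f x - f x‖ₑ ^ 2
      ≤ ∫⁻ y, ENNReal.ofReal (ρ y) * ‖f (x - y) - f x‖ₑ ^ 2 := by
    intro x
    have hce : Integrable (fun y => ρ y * f (x - y)) :=
      ψ.hasCompactSupport_normed.convolutionExists_left
        (ContinuousLinearMap.lsmul ℝ ℝ) hρc (L2_locallyIntegrable f) x
    have e : mollify ψ f x - f x = ∫ y, (f (x - y) - f x) ∂ν := by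
      have e1 : ∫ y, (f (x - y) - f x) ∂ν = ∫ y, ρ y * (f (x - y) - f x) := by
        rw [integral_withDensity_eq_integral_toReal_smul hρm (by simp)]
        simp [ENNReal.toReal_ofReal, hρ0]
      rw [e1]
      simp_rw [mul_sub]
      rw [integral_sub hce (hρint.mul_const _), integral_mul_const, hρi, one_mul]
      rfl
    rw [e]
    refine (enorm_integral_sq_le ?_).trans_eq ?_
    · exact ((hfm.comp (measurable_const.sub measurable_id)).sub_const _).aestronglyMeasurable
    · rw [lintegral_withDensity_eq_lintegral_mul _ hρm]
      · rfl
      · exact ((hfm.comp (measurable_const.sub measurable_id)).sub_const _).enorm.pow_const 2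
  have hsq : eLpNorm (fun x => mollify ψ f x - f x) 2 volume ^ 2 ≤ ε ^ 2 := by
    rw [eLpNorm_two_sq]
    calc _ ≤ ∫⁻ x, ∫⁻ y, ENNReal.ofReal (ρ y) * ‖f (x - y) - f x‖ₑ ^ 2 := lintegral_mono key
      _ = ∫⁻ y, ∫⁻ x, ENNReal.ofReal (ρ y) * ‖f (x - y) - f x‖ₑ ^ 2 := by
        refine lintegral_lintegral_swap (Measurable.aemeasurable ?_)
        refine (hρm.comp measurable_snd).mul (Measurable.pow_const (Measurable.enorm ?_) 2)
        exact (hfm.comp (measurable_fst.sub measurable_snd)).sub (hfm.comp measurable_fst)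
      _ ≤ ∫⁻ y, ENNReal.ofReal (ρ y) * ε ^ 2 := by
        refine lintegral_mono fun y => ?_
        rw [lintegral_const_mul]
        · by_cases hy : ‖y‖ < ψ.rOut
          · gcongr
            rw [← eLpNorm_two_sq]
            gcongr
            exact h y hy
          · have : ρ y = 0 := by
              have : y ∉ Function.support ρ := by
                rw [hρ, ψ.support_normed_eq]; simpa using hy
              simpa using this
            simp [this]
        · exact (((hfm.comp (measurable_id.sub_const y)).sub hfm).enorm).pow_const 2
      _ = ε ^ 2 := by rw [lintegral_mul_const _ hρm, hlρ, one_mul]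
  exact (ENNReal.pow_le_pow_left_iff (by norm_num)).1 hsq

/-- Translations act continuously on `L_2`. -/
theorem L2_translation_continuous (f : L2 d) {ε : ℝ} (hε : 0 < ε) : ∃ δ > 0, ∀ y : 𝕍 d, ‖y‖ < δ →
    eLpNorm (fun x => f (x - y) - f x) 2 volume ≤ ENNReal.ofReal ε := by
  have hg : Continuous fun y : 𝕍 d => (⟨fun x => x - y, by fun_prop⟩ : C(𝕍 d, 𝕍 d)) :=
    ContinuousMap.continuous_of_continuous_uncurry _ (by
      change Continuous fun p : 𝕍 d × 𝕍 d => p.2 - p.1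
      fun_prop)
  have hm : ∀ y : 𝕍 d, MeasurePreserving (fun x : 𝕍 d => x - y) volume volume :=
    fun y => measurePreserving_sub_right _ y
  have hc : Continuous fun y : 𝕍 d => Lp.compMeasurePreserving _ (hm y) f :=
    Continuous.compMeasurePreservingLp (f := fun _ : 𝕍 d => f) continuous_const hg hm (by norm_num)
  have h0 : Lp.compMeasurePreserving _ (hm 0) f = f := by
    refine Lp.ext ((Lp.coeFn_compMeasurePreserving f (hm 0)).trans ?_)
    exact ae_of_all _ fun x => by simp
  obtain ⟨δ, hδ, H⟩ := Metric.continuous_iff.1 hc 0 ε hε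
  refine ⟨δ, hδ, fun y hy => ?_⟩
  have hd := (H y (by simpa using hy)).le
  rw [h0, dist_eq_norm_sub, Lp.norm_def] at hd
  have hle := (ENNReal.le_ofReal_iff_toReal_le (Lp.eLpNorm_ne_top _) hε.le).2 hd
  refine le_trans (le_of_eq (eLpNorm_congr_ae ?_)) hle
  filter_upwards [Lp.coeFn_sub (Lp.compMeasurePreserving _ (hm y) f) f,
    Lp.coeFn_compMeasurePreserving f (hm y)] with x h1 h2
  rw [h1, Pi.sub_apply, h2]
  rfl

/-- `g` is the weak partial derivative `∂_i f`. -/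
def HasPartial (i : Fin d) (f g : L2 d) : Prop :=
  ∀ φ : 𝕍 d → ℝ, ContDiff ℝ ∞ φ → HasCompactSupport φ →
    ∫ x, f x * partialD i φ x = - ∫ x, g x * φ x

/-- `φ` is a `C^1` representative of `f`, whose classical partial derivatives represent `g`. -/
structure IsC1Rep (φ : 𝕍 d → ℝ) (f : L2 d) (g : Fin d → L2 d) : Prop where
  contDiff : ContDiff ℝ 1 φ
  coe_eq : f =ᵐ[volume] φ
  coe_partial : ∀ i, g i =ᵐ[volume] partialD i φ

/-- The classical derivative of a mollification is the mollification of the weak derivative. -/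
theorem mollify_partialD (ψ : ContDiffBump (0 : 𝕍 d)) {i : Fin d} {f g : L2 d}
    (h : HasPartial i f g) (x : 𝕍 d) : partialD i (mollify ψ f) x = mollify ψ g x := by
  set ρ : 𝕍 d → ℝ := ψ.normed volume with hρ
  have hρs : ContDiff ℝ ∞ ρ := ψ.contDiff_normed
  have hcs : HasCompactSupport ρ := ψ.hasCompactSupport_normed
  have h1 := hcs.hasFDerivAt_convolution_left (ContinuousLinearMap.lsmul ℝ ℝ)
    (hρs.of_le (by exact_mod_cast le_top)) (L2_locallyIntegrable f) x
  have hcs' : HasCompactSupport (fun y => ρ (x - y)) :=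
    hcs.comp_homeomorph (Homeomorph.subLeft x)
  -- The weak derivative is tested with the kernel `y ↦ ρ (x - y)`.
  have h2 := h (fun y => ρ (x - y)) (hρs.comp (contDiff_const.sub contDiff_id)) hcs'
  have h3 : ∀ y, partialD i (fun y => ρ (x - y)) y = - partialD i ρ (x - y) := by
    intro y
    unfold partialD
    have := ((hρs.differentiable (by norm_num) (x - y)).hasFDerivAt).comp y
      ((hasFDerivAt_id y).const_sub x)
    rw [HasFDerivAt.fderiv (f := fun y => ρ (x - y)) this]
    simp
  have hi : ConvolutionExistsAt (fderiv ℝ ρ) f x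
      ((ContinuousLinearMap.lsmul ℝ ℝ).precompL (𝕍 d)) volume :=
    (hcs.fderiv ℝ).convolutionExists_left _ (hρs.continuous_fderiv (by norm_num))
      (L2_locallyIntegrable f) x
  have e1 : partialD i (mollify ψ f) x = ∫ y, partialD i ρ y * f (x - y) := by
    unfold partialD mollify
    rw [h1.fderiv]
    unfold MeasureTheory.convolution
    rw [ContinuousLinearMap.integral_apply hi]
    rfl
  rw [e1, ← integral_sub_left_eq_self (fun y => partialD i ρ y * f (x - y)) volume x]
  simp only [sub_sub_cancel]
  have e2 : mollify ψ g x = ∫ y, ρ (x - y) * g y := by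
    unfold mollify MeasureTheory.convolution
    rw [← integral_sub_left_eq_self _ volume x]
    simp [hρ]
  rw [e2]
  simp only [h3, mul_neg, integral_neg, neg_inj] at h2
  simpa [mul_comm] using h2

theorem mollify_memLp (ψ : ContDiffBump (0 : 𝕍 d)) (f : L2 d) : MemLp (mollify ψ f) 2 volume := by
  have hm : AEStronglyMeasurable (mollify ψ f) volume :=
    (mollify_contDiff ψ f).continuous.aestronglyMeasurable
  have hf := Lp.memLp f
  have h : eLpNorm (fun x => mollify ψ f x - f x) 2 volume
      ≤ eLpNorm f 2 volume + eLpNorm f 2 volume := by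
    refine eLpNorm_mollify_sub_le ψ f _ fun y _ => ?_
    have hy : MeasurePreserving (fun x : 𝕍 d => x - y) volume volume :=
      measurePreserving_sub_right _ y
    have hc := hf.comp_measurePreserving hy
    refine (eLpNorm_sub_le hc.1 hf.1 (by norm_num)).trans (le_of_eq ?_)
    rw [eLpNorm_comp_measurePreserving hf.1 hy]
  have h' : MemLp (fun x => mollify ψ f x - f x) 2 volume :=
    ⟨hm.sub hf.1, h.trans_lt (ENNReal.add_lt_top.2 ⟨hf.2, hf.2⟩)⟩
  have := h'.add hf
  refine this.ae_eq (ae_of_all _ fun x => ?_)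
  simp

/-- A bump function concentrating at the origin as `n → ∞`. -/
noncomputable def shrinkingBump (n : ℕ) : ContDiffBump (0 : 𝕍 d) where
  rIn := 1 / (n + 2)
  rOut := 1 / (n + 1)
  rIn_pos := by positivity
  rIn_lt_rOut := one_div_lt_one_div_of_lt (by positivity) (by linarith)

theorem tendsto_mollify (f : L2 d) : Filter.Tendsto
    (fun n => (mollify_memLp (shrinkingBump n) f).toLp _) Filter.atTop (𝓝 f) := by
  rw [Metric.tendsto_atTop]
  intro ε hε
  obtain ⟨δ, hδ, H⟩ := L2_translation_continuous f (half_pos hε)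
  obtain ⟨N, hN⟩ := exists_nat_one_div_lt hδ
  refine ⟨N, fun n hn => ?_⟩
  have h1 : (1 : ℝ) / (n + 1) < δ := (one_div_le_one_div_of_le (by positivity)
    (by exact_mod_cast Nat.succ_le_succ hn)).trans_lt hN
  have h2 := eLpNorm_mollify_sub_le (shrinkingBump n) f (ENNReal.ofReal (ε / 2))
    fun y hy => H y (lt_trans hy h1)
  rw [dist_eq_norm_sub, Lp.norm_def]
  refine lt_of_le_of_lt ?_ (half_lt_self hε)
  refine ENNReal.toReal_le_of_le_ofReal (half_pos hε).le (le_trans (le_of_eq ?_) h2)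
  refine eLpNorm_congr_ae ?_
  filter_upwards [Lp.coeFn_sub ((mollify_memLp (shrinkingBump n) f).toLp _) f,
    (mollify_memLp (shrinkingBump n) f).coeFn_toLp] with x h3 h4
  rw [h3, Pi.sub_apply, h4]

/-- Every `f` with weak gradient `g` in `L_2` is a limit of functions with a `C^1`
representative, together with its gradient. -/
theorem mem_closure_isC1Rep {f : L2 d} {g : Fin d → L2 d} (h : ∀ i, HasPartial i f (g i)) :
    (f, g) ∈ closure {p : L2 d × (Fin d → L2 d) | ∃ φ, IsC1Rep φ p.1 p.2} := by
  refine mem_closure_of_tendsto ((tendsto_mollify f).prodMk_nhds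
    (tendsto_pi_nhds.2 fun i => tendsto_mollify (g i))) (Filter.Eventually.of_forall fun n => ?_)
  refine ⟨mollify (shrinkingBump n) f, (mollify_contDiff _ f).of_le (by exact_mod_cast le_top),
    (mollify_memLp _ f).coeFn_toLp, fun i => ?_⟩
  refine (mollify_memLp _ (g i)).coeFn_toLp.trans (ae_of_all _ fun x => ?_)
  exact (mollify_partialD _ (h i) x).symm

/-- A closed property of pairs `(f, ∇f)` that holds for functions with a `C^1` representative holds
for all functions with a weak gradient. -/
theorem gradient_induction {P : L2 d → (Fin d → L2 d) → Prop}
    (hP : IsClosed {p : L2 d × (Fin d → L2 d) | P p.1 p.2})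
    (hC : ∀ φ f g, IsC1Rep φ f g → P f g)
    {f : L2 d} {g : Fin d → L2 d} (h : ∀ i, HasPartial i f (g i)) : P f g :=
  closure_minimal (s := {p : L2 d × (Fin d → L2 d) | ∃ φ, IsC1Rep φ p.1 p.2})
    (fun p ⟨φ, hφ⟩ => hC φ p.1 p.2 hφ) hP (mem_closure_isC1Rep h)

theorem partialD_continuous {i : Fin d} {φ : 𝕍 d → ℝ} (h : ContDiff ℝ 1 φ) :
    Continuous (partialD i φ) :=
  (partialD_contDiff (n := 0) (by simpa using h)).continuous

/-- Integration by parts of a `C^1` function against a compactly supported one. -/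
theorem integral_mul_partialD {i : Fin d} {φ ψ : 𝕍 d → ℝ} (h : ContDiff ℝ 1 φ) (h' : ContDiff ℝ 1 ψ)
    (hψ : HasCompactSupport ψ) : ∫ x, φ x * partialD i ψ x = - ∫ x, partialD i φ x * ψ x := by
  refine integral_mul_fderiv_eq_neg_fderiv_mul_of_integrable
    (v := EuclideanSpace.single i (1 : ℝ)) ?_ ?_ ?_
    (fun x _ => h.differentiable one_ne_zero x) (fun x _ => h'.differentiable one_ne_zero x)
  · exact ((partialD_continuous (i := i) h).mul h'.continuous).integrable_of_hasCompactSupport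
      hψ.mul_left
  · exact (h.continuous.mul (partialD_continuous (i := i) h')).integrable_of_hasCompactSupport
      (partialD_hasCompactSupport i hψ).mul_left
  · exact (h.continuous.mul h'.continuous).integrable_of_hasCompactSupport hψ.mul_left

theorem IsC1Rep.hasPartial {φ : 𝕍 d → ℝ} {f : L2 d} {g : Fin d → L2 d} (h : IsC1Rep φ f g)
    (i : Fin d) : HasPartial i f (g i) := by
  intro ψ hψ hc
  have e1 : ∫ x, f x * partialD i ψ x = ∫ x, φ x * partialD i ψ x :=
    integral_congr_ae (by filter_upwards [h.coe_eq] with x hx; rw [hx])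
  have e2 : ∫ x, g i x * ψ x = ∫ x, partialD i φ x * ψ x :=
    integral_congr_ae (by filter_upwards [h.coe_partial i] with x hx; rw [hx])
  rw [e1, e2]
  exact integral_mul_partialD h.contDiff (hψ.of_le (by exact_mod_cast le_top)) hc

theorem L2_inner_eq (f g : L2 d) : inner ℝ f g = ∫ x, f x * g x := by
  rw [L2.inner_def]
  simp [mul_comm]

theorem L2_mul_integrable (f g : L2 d) : Integrable fun x => f x * g x :=
  MemLp.integrable_mul (Lp.memLp f) (Lp.memLp g)

theorem testFunction_memLp {φ : 𝕍 d → ℝ} (hφ : Continuous φ) (hc : HasCompactSupport φ) :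
    MemLp φ 2 volume :=
  hφ.memLp_of_hasCompactSupport hc

theorem integral_mul_test (f : L2 d) {φ : 𝕍 d → ℝ} (hφ : MemLp φ 2 volume) :
    ∫ x, f x * φ x = inner ℝ f (hφ.toLp φ) := by
  rw [L2_inner_eq]
  exact integral_congr_ae (by filter_upwards [hφ.coeFn_toLp] with x hx; rw [hx])

/-- Weak differentiation is a closed operator. -/
theorem isClosed_hasPartial (i : Fin d) {X : Type*} [TopologicalSpace X] {A B : X → L2 d}
    (hA : Continuous A) (hB : Continuous B) : IsClosed {p : X | HasPartial i (A p) (B p)} := by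
  have : {p : X | HasPartial i (A p) (B p)} = ⋂ (φ : 𝕍 d → ℝ) (hφ : ContDiff ℝ ∞ φ)
      (hc : HasCompactSupport φ), {p : X | ∫ x, A p x * partialD i φ x = - ∫ x, B p x * φ x} := by
    ext p
    simp [HasPartial]
  rw [this]
  refine isClosed_iInter fun φ => isClosed_iInter fun hφ => isClosed_iInter fun hc => ?_
  simp_rw [integral_mul_test _ (testFunction_memLp hφ.continuous hc), integral_mul_test _
    (testFunction_memLp (partialD_smooth i hφ).continuous (partialD_hasCompactSupport i hc))]
  exact isClosed_eq (hA.inner continuous_const) (hB.inner continuous_const).neg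

theorem HasPartial.add {i : Fin d} {f g f' g' : L2 d} (h : HasPartial i f g)
    (h' : HasPartial i f' g') : HasPartial i (f + f') (g + g') := by
  intro φ hφ hc
  have h1 := h φ hφ hc
  have h2 := h' φ hφ hc
  simp only [integral_mul_test _ (testFunction_memLp hφ.continuous hc), integral_mul_test _
    (testFunction_memLp (partialD_smooth i hφ).continuous (partialD_hasCompactSupport i hc)),
    inner_add_left] at h1 h2 ⊢
  linarith

theorem HasPartial.zero {i : Fin d} : HasPartial i (0 : L2 d) 0 := by
  intro φ hφ hc
  rw [integral_mul_test _ (testFunction_memLp hφ.continuous hc), integral_mul_test _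
    (testFunction_memLp (partialD_smooth i hφ).continuous (partialD_hasCompactSupport i hc))]
  simp

theorem HasPartial.sum {ι : Type*} (s : Finset ι) {i : Fin d} {f g : ι → L2 d}
    (h : ∀ a, HasPartial i (f a) (g a)) : HasPartial i (∑ a ∈ s, f a) (∑ a ∈ s, g a) := by
  classical
  induction s using Finset.induction_on with
  | empty => simpa using HasPartial.zero
  | insert a s ha ih => rw [Finset.sum_insert ha, Finset.sum_insert ha]; exact (h a).add ih

/-- Integration by parts in `H^1`. -/
theorem inner_partial_eq_neg {f f' : L2 d} {g g' : Fin d → L2 d} (h : ∀ i, HasPartial i f (g i))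
    (h' : ∀ i, HasPartial i f' (g' i)) (i : Fin d) :
    inner ℝ (g i) f' = - inner ℝ f (g' i) := by
  have hcl : ∀ {X : Type} [TopologicalSpace X] {A B C D : X → L2 d}, Continuous A → Continuous B →
      Continuous C → Continuous D → IsClosed {p | inner ℝ (A p) (B p) = - inner ℝ (C p) (D p)} :=
    fun hA hB hC hD => isClosed_eq (hA.inner hB) (hC.inner hD).neg
  refine gradient_induction (P := fun f g => inner ℝ (g i) f' = - inner ℝ f (g' i))
    (hcl (by fun_prop) (by fun_prop) (by fun_prop) (by fun_prop)) (fun φ f g hφ => ?_) h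
  refine gradient_induction (P := fun f' g' => inner ℝ (g i) f' = - inner ℝ f (g' i))
    (hcl (by fun_prop) (by fun_prop) (by fun_prop) (by fun_prop)) (fun ψ f' g' hψ => ?_) h'
  have e1 := L2_mul_integrable (g i) f'
  have e2 := L2_mul_integrable f (g' i)
  have e3 := L2_mul_integrable f f'
  have c1 : (fun x => g i x * f' x) =ᵐ[volume] fun x => partialD i φ x * ψ x := by
    filter_upwards [hφ.coe_partial i, hψ.coe_eq] with x h1 h2; rw [h1, h2]
  have c2 : (fun x => f x * g' i x) =ᵐ[volume] fun x => φ x * partialD i ψ x := by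
    filter_upwards [hψ.coe_partial i, hφ.coe_eq] with x h1 h2; rw [h1, h2]
  have c3 : (fun x => f x * f' x) =ᵐ[volume] fun x => φ x * ψ x := by
    filter_upwards [hψ.coe_eq, hφ.coe_eq] with x h1 h2; rw [h1, h2]
  rw [L2_inner_eq, L2_inner_eq, integral_congr_ae c1, integral_congr_ae c2]
  have := integral_mul_fderiv_eq_neg_fderiv_mul_of_integrable (μ := volume) (f := φ) (g := ψ)
    (v := EuclideanSpace.single i (1 : ℝ)) (e1.congr c1) (e2.congr c2) (e3.congr c3)
    (fun x _ => hφ.contDiff.differentiable one_ne_zero x)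
    (fun x _ => hψ.contDiff.differentiable one_ne_zero x)
  unfold partialD
  rw [this, neg_neg]

end Mollify

/-! ### The maps `x ↦ x + θ c(x)` -/

section Geometry

variable {d : ℕ}

/-- A bounded displacement field `c` all of whose components have derivatives up to order `m + 1`
bounded by `κ ≤ K`, and such that the Jacobians of `x + θ c(x)`, `θ ∈ [0,1]`, are bounded away from
zero. -/
structure JumpField (m : ℕ) (K κ : ℝ) (c : 𝕍 d → 𝕍 d) : Prop where
  contDiff : ContDiff ℝ 1 c
  le : κ ≤ K
  norm_le : ∀ x, ‖c x‖ ≤ κ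
  derivBound : ∀ j, DerivBound (m + 1) κ fun x => c x j
  le_abs_det : ∀ x, ∀ θ ∈ Set.Icc (0 : ℝ) 1,
    K⁻¹ ≤ |(ContinuousLinearMap.id ℝ (𝕍 d) + θ • fderiv ℝ c x).det|

theorem eq_sum_smul_single (v : 𝕍 d) : v = ∑ j, v j • EuclideanSpace.single j (1 : ℝ) := by
  ext k; simp [Finset.sum_apply, Pi.single_apply]

theorem norm_le_sum_abs {e : ℕ} (w : 𝕍 e) : ‖w‖ ≤ ∑ j, |w j| := by
  calc ‖w‖ = ‖∑ j, w j • EuclideanSpace.single j (1 : ℝ)‖ := by rw [← eq_sum_smul_single]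
    _ ≤ ∑ j, ‖w j • EuclideanSpace.single j (1 : ℝ)‖ := norm_sum_le _ _
    _ = ∑ j, |w j| := by simp [norm_smul]

theorem abs_apply_le_norm (w : 𝕍 d) (j : Fin d) : |w j| ≤ ‖w‖ := by
  simpa using PiLp.norm_apply_le w j

theorem opNorm_le_of_entries {A : 𝕍 d →L[ℝ] 𝕍 d} {a : ℝ}
    (h : ∀ i j, |A (EuclideanSpace.single i 1) j| ≤ a) (ha : 0 ≤ a) : ‖A‖ ≤ d * (d * a) := by
  refine A.opNorm_le_bound (by positivity) fun v => ?_
  calc ‖A v‖ = ‖∑ j, v j • A (EuclideanSpace.single j (1 : ℝ))‖ := by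
        conv_lhs => rw [eq_sum_smul_single v]
        simp only [map_sum, map_smul]
    _ ≤ ∑ j, ‖v j • A (EuclideanSpace.single j (1 : ℝ))‖ := norm_sum_le _ _
    _ ≤ ∑ _j : Fin d, ‖v‖ * (d * a) := by
        refine Finset.sum_le_sum fun j _ => ?_
        rw [norm_smul]
        refine mul_le_mul (abs_apply_le_norm v j) ?_ (norm_nonneg _) (norm_nonneg _)
        refine (norm_le_sum_abs _).trans ((Finset.sum_le_sum fun i _ => h j i).trans ?_)
        simp
    _ = d * (d * a) * ‖v‖ := by simp; ring

variable {m : ℕ} {K κ : ℝ} {c : 𝕍 d → 𝕍 d}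

theorem partialD_component {c : 𝕍 d → 𝕍 d} (h : ContDiff ℝ 1 c) (i j : Fin d) (x : 𝕍 d) :
    partialD i (fun y => c y j) x = fderiv ℝ c x (EuclideanSpace.single i 1) j := by
  have := (EuclideanSpace.proj (𝕜 := ℝ) j : 𝕍 d →L[ℝ] ℝ).hasFDerivAt.comp x
    (h.differentiable one_ne_zero x).hasFDerivAt
  have h2 : (⇑(EuclideanSpace.proj (𝕜 := ℝ) j : 𝕍 d →L[ℝ] ℝ) ∘ c) = fun x => c x j := rfl
  rw [h2] at this
  unfold partialD
  rw [this.fderiv]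
  simp

namespace JumpField

theorem nonneg (h : JumpField m K κ c) : 0 ≤ κ := (norm_nonneg _).trans (h.norm_le 0)

theorem abs_entry_le (h : JumpField m K κ c) (x : 𝕍 d) (i j : Fin d) :
    |fderiv ℝ c x (EuclideanSpace.single i 1) j| ≤ κ := by
  rw [← partialD_component h.contDiff]
  exact ((h.derivBound j).2.2 i).abs_le x

theorem norm_fderiv_le (h : JumpField m K κ c) (x : 𝕍 d) : ‖fderiv ℝ c x‖ ≤ d * (d * κ) :=
  opNorm_le_of_entries (h.abs_entry_le x) h.nonneg

theorem smul (h : JumpField m K κ c) {t : ℝ} (ht : t ∈ Set.Icc (0 : ℝ) 1) :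
    JumpField m K κ (fun x => t • c x) where
  contDiff := h.contDiff.const_smul t
  le := h.le
  norm_le x := by
    rw [norm_smul, Real.norm_of_nonneg ht.1]
    exact (mul_le_of_le_one_left (norm_nonneg _) ht.2).trans (h.norm_le x)
  derivBound j := (h.derivBound j).const_mul (abs_le.2 ⟨by linarith [ht.1], ht.2⟩)
  le_abs_det x θ hθ := by
    have := h.le_abs_det x (θ * t) ⟨mul_nonneg hθ.1 ht.1, mul_le_one₀ hθ.2 ht.1 ht.2⟩
    rwa [fderiv_fun_const_smul (h.contDiff.differentiable one_ne_zero x), smul_smul]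

theorem hasFDerivAt (h : JumpField m K κ c) (x : 𝕍 d) :
    HasFDerivAt (fun x => x + c x) (ContinuousLinearMap.id ℝ (𝕍 d) + fderiv ℝ c x) x :=
  (hasFDerivAt_id x).add (h.contDiff.differentiable one_ne_zero x).hasFDerivAt

theorem le_abs_det_one (h : JumpField m K κ c) (x : 𝕍 d) :
    K⁻¹ ≤ |(ContinuousLinearMap.id ℝ (𝕍 d) + fderiv ℝ c x).det| := by
  simpa using h.le_abs_det x 1 (by simp)

theorem one_le (h : JumpField m K κ c) (hK : 0 < K) : 1 ≤ K := by
  have := h.le_abs_det 0 0 (by simp)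
  rw [zero_smul ℝ (fderiv ℝ c 0), add_zero] at this
  have e : (ContinuousLinearMap.id ℝ (𝕍 d)).det = 1 := by simp [ContinuousLinearMap.det]
  rw [e, abs_one] at this
  exact (inv_le_one₀ hK).1 this

/-- The determinant of `1 + θ Dc` does not vanish for `θ ∈ [0,1]` and is `1` for `θ = 0`. -/
theorem det_pos (h : JumpField m K κ c) (hK : 0 < K) (x : 𝕍 d) :
    0 < (ContinuousLinearMap.id ℝ (𝕍 d) + fderiv ℝ c x).det := by
  by_contra! hneg
  have hc : ContinuousOn (fun θ : ℝ => (ContinuousLinearMap.id ℝ (𝕍 d) + θ • fderiv ℝ c x).det)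
      (Set.Icc 0 1) :=
    (ContinuousLinearMap.continuous_det.comp (by fun_prop)).continuousOn
  have e : (ContinuousLinearMap.id ℝ (𝕍 d)).det = 1 := by simp [ContinuousLinearMap.det]
  obtain ⟨θ, hθ, h0⟩ := intermediate_value_Icc' zero_le_one hc
    (show (0 : ℝ) ∈ _ by
      rw [zero_smul ℝ (fderiv ℝ c x), one_smul ℝ (fderiv ℝ c x), add_zero, e]
      exact ⟨hneg, zero_le_one⟩)
  have := h.le_abs_det x θ hθ
  simp only at h0
  rw [h0, abs_zero] at this
  exact absurd (inv_pos.2 hK) (not_lt.2 this)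

end JumpField

/-- Linear maps with bounded norm and with determinant bounded away from zero are uniformly bounded
below. -/
theorem exists_uniform_lower_bound (d : ℕ) (R : ℝ) {K : ℝ} (hK : 0 < K) :
    ∃ δ > 0, ∀ A : 𝕍 d →L[ℝ] 𝕍 d, ‖A‖ ≤ R →
      K⁻¹ ≤ |A.det| → ∀ v, δ * ‖v‖ ≤ ‖A v‖ := by
  let S : Set (𝕍 d →L[ℝ] 𝕍 d) :=
    {A | ‖A‖ ≤ R ∧ K⁻¹ ≤ |A.det|}
  have hS : IsCompact S := by
    refine (isCompact_closedBall (0 : 𝕍 d →L[ℝ] 𝕍 d)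
      R).of_isClosed_subset ?_ fun A hA => by simpa using hA.1
    exact (isClosed_le continuous_norm continuous_const).inter
      (isClosed_le continuous_const ContinuousLinearMap.continuous_det.abs)
  have hP := hS.prod (isCompact_sphere (0 : 𝕍 d) 1)
  obtain ⟨δ, hδ, H⟩ := hP.exists_forall_le' (f := fun p => ‖p.1 p.2‖) (a := 0)
    (by fun_prop) (by
      rintro ⟨A, v⟩ ⟨hA, hv⟩
      have hdet : A.det ≠ 0 := by
        intro h0
        have := hA.2
        rw [h0, abs_zero] at this
        exact absurd (inv_pos.2 hK) (not_lt.2 this)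
      rw [norm_pos_iff]
      intro h0
      have hv0 : v = 0 := by
        have hinj := (A.toContinuousLinearEquivOfDetNeZero hdet).injective
        exact hinj (by simpa using h0)
      simp [hv0] at hv)
  refine ⟨δ, hδ, fun A h1 h2 v => ?_⟩
  by_cases hv : v = 0
  · simp [hv]
  · have := H (A, ‖v‖⁻¹ • v) ⟨⟨h1, h2⟩, by simp [norm_smul, hv]⟩
    simp only [map_smul, norm_smul, norm_inv, norm_norm] at this
    rwa [le_inv_mul_iff₀ (norm_pos_iff.2 hv), mul_comm] at this

/-- A `C^1` map which is antilipschitz with some constant, and whose derivative is bounded below by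
`δ`, is bijective and antilipschitz with constant `δ⁻¹`. -/
theorem bijective_antilipschitz_of_antilipschitz {f : 𝕍 d → 𝕍 d} (hf : ContDiff ℝ 1 f) {L : NNReal}
    (hL : LipschitzWith L f) {A : NNReal} (hA : AntilipschitzWith A f) {δ : NNReal} (hδ : 0 < δ)
    (hdet : ∀ x, (fderiv ℝ f x).det ≠ 0) (hb : ∀ x v, δ * ‖v‖ ≤ ‖fderiv ℝ f x v‖) :
    Function.Bijective f ∧ AntilipschitzWith δ⁻¹ f := by
  let e : 𝕍 d → 𝕍 d ≃L[ℝ] 𝕍 d := fun x => (fderiv ℝ f x).toContinuousLinearEquivOfDetNeZero (hdet x)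
  have he : ∀ x, (e x : 𝕍 d →L[ℝ] 𝕍 d) = fderiv ℝ f x := fun x => by
    ext v; simp [e]
  have hs : ∀ x, HasStrictFDerivAt f (e x : 𝕍 d →L[ℝ] 𝕍 d) x := fun x => by
    rw [he]; exact hf.contDiffAt.hasStrictFDerivAt one_ne_zero
  have hopen : IsOpenMap f := isOpenMap_of_hasStrictFDerivAt_equiv hs
  -- The range is open by the inverse function theorem and closed by the antilipschitz bound.
  have hsurj : Function.Surjective f := by
    rw [← Set.range_eq_univ]
    exact IsClopen.eq_univ ⟨hA.isClosed_range hL.uniformContinuous, hopen.isOpen_range⟩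
      (Set.range_nonempty f)
  have hbij : Function.Bijective f := ⟨hA.injective, hsurj⟩
  refine ⟨hbij, ?_⟩
  let g := (Equiv.ofBijective f hbij).symm
  have hfg : ∀ y, f (g y) = y := (Equiv.ofBijective f hbij).apply_symm_apply
  have hgf : ∀ x, g (f x) = x := (Equiv.ofBijective f hbij).symm_apply_apply
  have hgc : Continuous g := (hA.to_rightInverse hfg).continuous
  have hgd : ∀ y, HasFDerivAt g ((e (g y)).symm : 𝕍 d →L[ℝ] 𝕍 d) y := fun y =>
    HasFDerivAt.of_local_left_inverse (f := f) hgc.continuousAt (hs (g y)).hasFDerivAt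
      (Filter.Eventually.of_forall hfg)
  have hglip : LipschitzWith δ⁻¹ g := by
    refine lipschitzWith_of_nnnorm_fderiv_le (𝕜 := ℝ) (fun y => (hgd y).differentiableAt)
      fun y => ?_
    rw [(hgd y).fderiv, ← NNReal.coe_le_coe, coe_nnnorm]
    refine ContinuousLinearMap.opNorm_le_bound _ (NNReal.coe_nonneg _) fun w => ?_
    have h1 := hb (g y) ((e (g y)).symm w)
    have h2 : fderiv ℝ f (g y) ((e (g y)).symm w) = w := by
      rw [← he]; simp
    rw [h2] at h1
    rw [NNReal.coe_inv, inv_mul_eq_div, le_div_iff₀' (by exact_mod_cast hδ)]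
    exact h1
  exact hglip.to_rightInverse hgf

/-- The map `x ↦ x + c(x)` is a bijection: `x ↦ x + θ c(x)` is antilipschitz with a constant
independent of `θ`, which allows continuation from `θ = 0` to `θ = 1` in small steps. -/
theorem JumpField.bijective (h : JumpField m K κ c) (hK : 0 < K) :
    Function.Bijective fun x => x + c x := by
  obtain ⟨δ, hδ, H⟩ := exists_uniform_lower_bound d (1 + d * (d * κ)) hK
  lift δ to NNReal using hδ.le
  have hδ' : 0 < δ := by exact_mod_cast hδ
  have hκ := h.nonneg
  obtain ⟨L, hLd⟩ : ∃ L : NNReal, (L : ℝ) = d * (d * κ) := ⟨⟨d * (d * κ), by positivity⟩, rfl⟩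
  have hcL : LipschitzWith L c := lipschitzWith_of_nnnorm_fderiv_le (𝕜 := ℝ)
    (h.contDiff.differentiable one_ne_zero) fun x => by
      rw [← NNReal.coe_le_coe, coe_nnnorm, hLd]; exact h.norm_fderiv_le x
  have step : ∀ t ∈ Set.Icc (0 : ℝ) 1, ∀ A : NNReal, AntilipschitzWith A (fun x => x + t • c x) →
      Function.Bijective (fun x => x + t • c x) ∧ AntilipschitzWith δ⁻¹ (fun x => x + t • c x) := by
    intro t ht A hA
    have ht' := h.smul ht
    have hfd : ∀ x, fderiv ℝ (fun x => x + t • c x) x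
        = ContinuousLinearMap.id ℝ (𝕍 d) + fderiv ℝ (fun x => t • c x) x :=
      fun x => (ht'.hasFDerivAt x).fderiv
    have hn : ∀ x, ‖fderiv ℝ (fun x => x + t • c x) x‖ ≤ 1 + d * (d * κ) := fun x => by
      rw [hfd]
      exact (norm_add_le _ _).trans
        (add_le_add ContinuousLinearMap.norm_id_le (ht'.norm_fderiv_le x))
    have hcd : ContDiff ℝ 1 (fun x => x + t • c x) := contDiff_id.add ht'.contDiff
    refine bijective_antilipschitz_of_antilipschitz hcd (L := 1 + L) ?_ hA hδ' ?_ ?_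
    · refine lipschitzWith_of_nnnorm_fderiv_le (𝕜 := ℝ)
        (hcd.differentiable one_ne_zero) fun x => ?_
      rw [← NNReal.coe_le_coe, coe_nnnorm]; push_cast; rw [hLd]; exact hn x
    · intro x; rw [hfd]; exact (ht'.det_pos hK x).ne'
    · intro x v
      refine H _ (hn x) ?_ v
      rw [hfd]; exact ht'.le_abs_det_one x
  -- A step of size `1 / N` changes the map by a Lipschitz constant `L / N < δ`.
  obtain ⟨N, hN⟩ := exists_nat_gt ((L : ℝ) * (δ⁻¹ : NNReal))
  have hN0 : (0 : ℝ) < N := lt_of_le_of_lt (by positivity) hN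
  have main : ∀ n : ℕ, n ≤ N → Function.Bijective (fun x => x + ((n : ℝ) / N) • c x) ∧
      AntilipschitzWith δ⁻¹ (fun x => x + ((n : ℝ) / N) • c x) := by
    intro n
    induction n with
    | zero =>
      intro _
      refine step _ (by simp) 1 ?_
      have e : (fun x => x + (((0 : ℕ) : ℝ) / N) • c x) = id := by funext x; simp
      rw [e]
      exact AntilipschitzWith.id
    | succ n ih =>
      intro hn
      have hA := (ih (by omega)).2
      have hl : LipschitzWith (L / N) (fun x => ((1 : ℝ) / N) • c x) := by
        refine LipschitzWith.of_dist_le_mul fun x y => ?_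
        rw [dist_smul₀, Real.norm_of_nonneg (by positivity)]
        push_cast
        have := hcL.dist_le_mul x y
        calc 1 / (N : ℝ) * dist (c x) (c y) ≤ 1 / N * (L * dist x y) := by gcongr
          _ = L / N * dist x y := by ring
      have hlt : L / N < (δ⁻¹)⁻¹ := by
        rw [← NNReal.coe_lt_coe]
        push_cast
        rw [inv_inv, div_lt_iff₀ hN0]
        rw [NNReal.coe_inv, ← div_eq_mul_inv, div_lt_iff₀ hδ] at hN
        linarith
      have e : (fun x => x + (((n + 1 : ℕ) : ℝ) / N) • c x)
          = fun x => (x + ((n : ℝ) / N) • c x) + ((1 : ℝ) / N) • c x := by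
        funext x
        rw [add_assoc, ← add_smul]
        push_cast
        ring_nf
      refine step _ ⟨by positivity, (div_le_one hN0).2 (by exact_mod_cast hn)⟩
        ((δ⁻¹)⁻¹ - L / N)⁻¹ ?_
      rw [e]
      exact hA.add_lipschitzWith hl hlt
  have := (main N le_rfl).1
  rw [div_self hN0.ne'] at this
  simpa using this

/-- Change of variables `y = x + c(x)`. -/
theorem JumpField.lintegral_comp (h : JumpField m K κ c) (hK : 0 < K) (g : 𝕍 d → ℝ≥0∞) :
    ∫⁻ y, g y = ∫⁻ x, ENNReal.ofReal |(ContinuousLinearMap.id ℝ (𝕍 d) + fderiv ℝ c x).det|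
      * g (x + c x) := by
  have := lintegral_image_eq_lintegral_abs_det_fderiv_mul volume MeasurableSet.univ
    (fun x _ => (h.hasFDerivAt x).hasFDerivWithinAt) (h.bijective hK).1.injOn g
  rwa [Set.image_univ, (h.bijective hK).2.range_eq, Measure.restrict_univ] at this

theorem JumpField.integral_comp (h : JumpField m K κ c) (hK : 0 < K) (g : 𝕍 d → ℝ) :
    ∫ y, g y = ∫ x, (ContinuousLinearMap.id ℝ (𝕍 d) + fderiv ℝ c x).det * g (x + c x) := by
  have := integral_image_eq_integral_abs_det_fderiv_smul volume MeasurableSet.univ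
    (fun x _ => (h.hasFDerivAt x).hasFDerivWithinAt) (h.bijective hK).1.injOn g
  rw [Set.image_univ, (h.bijective hK).2.range_eq, Measure.restrict_univ] at this
  rw [this]
  simp_rw [abs_of_pos (h.det_pos hK _), smul_eq_mul]

theorem JumpField.lintegral_comp_le (h : JumpField m K κ c) (hK : 0 < K) (g : 𝕍 d → ℝ≥0∞) :
    ∫⁻ x, g (x + c x) ≤ ENNReal.ofReal K * ∫⁻ y, g y := by
  rw [h.lintegral_comp hK g, ← lintegral_const_mul' _ _ ENNReal.ofReal_ne_top]
  refine lintegral_mono fun x => ?_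
  rw [← mul_assoc, ← ENNReal.ofReal_mul hK.le]
  refine le_mul_of_one_le_left zero_le ?_
  rw [ENNReal.one_le_ofReal]
  have := h.le_abs_det_one x
  rwa [inv_le_iff_one_le_mul₀ hK, mul_comm] at this

theorem JumpField.map_le (h : JumpField m K κ c) (hK : 0 < K) :
    (volume : Measure (𝕍 d)).map (fun x => x + c x) ≤ ENNReal.ofReal K • volume := by
  have hm : Measurable fun x => x + c x := (continuous_id.add h.contDiff.continuous).measurable
  refine Measure.le_iff.2 fun s hs => ?_
  rw [Measure.map_apply hm hs, Measure.smul_apply, smul_eq_mul, ← lintegral_indicator_one hs,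
    ← lintegral_indicator_one (hm hs)]
  exact h.lintegral_comp_le hK _

theorem JumpField.quasiMeasurePreserving (h : JumpField m K κ c) (hK : 0 < K) :
    Measure.QuasiMeasurePreserving (fun x => x + c x) (volume : Measure (𝕍 d)) volume :=
  ⟨(continuous_id.add h.contDiff.continuous).measurable,
    (Measure.absolutelyContinuous_of_le (h.map_le hK)).trans
      (Measure.AbsolutelyContinuous.rfl.smul_left _)⟩

/-! ### Expansion of the Jacobian -/

/-- The quadratic remainder of the expansion of `det (1 + A)` at `A = 0`. -/
theorem exists_det_bound (d : ℕ) (K : ℝ) : ∃ C, 0 ≤ C ∧ ∀ (A : Fin d → Fin d → ℝ) (κ : ℝ), κ ≤ K →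
    (∀ i j, |A i j| ≤ κ) → |(1 + Matrix.of A).det - 1 - ∑ i, A i i| ≤ C * κ ^ 2 := by
  let F : (Fin d → Fin d → ℝ) → ℝ := fun A => (1 + Matrix.of A).det - 1 - ∑ i, A i i
  have hF : ContDiff ℝ 2 F := by
    have h1 : ContDiff ℝ 2 fun A : Fin d → Fin d → ℝ => (1 + Matrix.of A).det := by
      simp only [Matrix.det_apply, Matrix.add_apply, Matrix.of_apply]
      refine ContDiff.sum fun σ _ => ContDiff.const_smul _ (contDiff_prod fun i _ => ?_)
      fun_prop
    exact (h1.sub contDiff_const).sub (by fun_prop)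
  -- `F` vanishes to first order at `0`, and its second derivative is bounded on bounded sets.
  have hF0 : F 0 = 0 := by simp [F]
  have hd : Differentiable ℝ F := hF.differentiable (by norm_num)
  have hF1 : fderiv ℝ F 0 = 0 := by
    ext A
    have h1 : HasDerivAt (fun t : ℝ => F (t • A)) (fderiv ℝ F 0 A) 0 := by
      have h2 : HasDerivAt (fun t : ℝ => t • A) A 0 := by
        simpa using (hasDerivAt_id (0 : ℝ)).smul_const A
      have h3 : HasFDerivAt F (fderiv ℝ F 0) ((0 : ℝ) • A) := by
        rw [zero_smul]; exact (hd 0).hasFDerivAt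
      exact h3.comp_hasDerivAt 0 h2
    obtain ⟨p, hp⟩ : ∃ p : Polynomial ℝ, ∀ t : ℝ, F (t • A) = p.eval t * t ^ 2 := by
      refine ⟨(1 + (Polynomial.X : Polynomial ℝ) •
        (Matrix.of A).map Polynomial.C).det.divX.divX, fun t => ?_⟩
      have := Matrix.det_one_add_smul t (Matrix.of A)
      have e : Matrix.of (t • A) = t • Matrix.of A := rfl
      simp only [F, e, this, Matrix.trace, Matrix.diag, Matrix.of_apply, Pi.smul_apply,
        smul_eq_mul, ← Finset.mul_sum]
      rw [mul_comm t, add_assoc, add_sub_cancel_left, add_sub_cancel_left]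
    have h4 : HasDerivAt (fun t : ℝ => F (t • A)) 0 0 := by
      have := (p.hasDerivAt 0).mul (hasDerivAt_pow 2 (0 : ℝ))
      have h5 : (fun t : ℝ => F (t • A)) = (fun t => p.eval t) * (fun t => t ^ 2) := funext hp
      rw [h5]
      simpa using this
    exact h1.unique h4
  obtain ⟨C, hC⟩ := (isCompact_closedBall (0 : Fin d → Fin d → ℝ) K).exists_bound_of_continuousOn
    (f := fderiv ℝ (fderiv ℝ F))
    ((hF.fderiv_right (m := 1) (by norm_num)).continuous_fderiv (by norm_num)).continuousOn
  refine ⟨max C 0, le_max_right _ _, fun A κ hκ hA => ?_⟩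
  by_cases hκ0 : 0 ≤ κ
  -- A negative `κ` is possible only for `d = 0`.
  swap
  · have : IsEmpty (Fin d) := ⟨fun i => hκ0 ((abs_nonneg _).trans (hA i i))⟩
    simp only [Matrix.det_isEmpty, Finset.univ_eq_empty, Finset.sum_empty]
    simp only [sub_self, abs_zero]
    positivity
  have hAn : ‖A‖ ≤ κ := (pi_norm_le_iff_of_nonneg hκ0).2 fun i =>
    (pi_norm_le_iff_of_nonneg hκ0).2 fun j => hA i j
  have hsub : Metric.closedBall (0 : Fin d → Fin d → ℝ) κ ⊆ Metric.closedBall 0 K :=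
    Metric.closedBall_subset_closedBall hκ
  have h1 : ∀ B ∈ Metric.closedBall (0 : Fin d → Fin d → ℝ) κ,
      ‖fderiv ℝ F B‖ ≤ max C 0 * κ := by
    intro B hB
    have := (convex_closedBall (0 : Fin d → Fin d → ℝ) κ).norm_image_sub_le_of_norm_fderiv_le
      (f := fderiv ℝ F) (𝕜 := ℝ) (C := max C 0)
      (fun x _ => (hF.fderiv_right (m := 1) (by norm_num)).differentiable (by norm_num) x)
      (fun x hx => (hC x (hsub hx)).trans (le_max_left _ _))
      (Metric.mem_closedBall_self hκ0) hB
    rw [hF1, sub_zero, sub_zero] at this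
    refine this.trans (mul_le_mul_of_nonneg_left (by simpa using hB) (le_max_right _ _))
  have h2 := (convex_closedBall (0 : Fin d → Fin d → ℝ) κ).norm_image_sub_le_of_norm_fderiv_le
      (f := F) (𝕜 := ℝ) (fun x _ => hd x) h1
      (Metric.mem_closedBall_self hκ0) (show A ∈ _ by simpa using hAn)
  rw [hF0, sub_zero, sub_zero, Real.norm_eq_abs] at h2
  refine h2.trans ?_
  rw [pow_two, ← mul_assoc]
  exact mul_le_mul_of_nonneg_left hAn (mul_nonneg (le_max_right _ _) hκ0)

/-- The divergence of a vector field. -/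
noncomputable def divergence (c : 𝕍 d → 𝕍 d) (x : 𝕍 d) : ℝ :=
  ∑ i, partialD i (fun y => c y i) x

theorem JumpField.det_eq (h : JumpField m K κ c) (x : 𝕍 d) :
    (ContinuousLinearMap.id ℝ (𝕍 d) + fderiv ℝ c x).det
      = (1 + Matrix.of fun i j => partialD j (fun y => c y i) x).det := by
  let b := (EuclideanSpace.basisFun (Fin d) ℝ).toBasis
  unfold ContinuousLinearMap.det
  rw [← LinearMap.det_toMatrix b]
  congr 1
  ext i j
  simp only [LinearMap.toMatrix_apply, b, Matrix.add_apply, Matrix.of_apply,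
    partialD_component h.contDiff]
  simp [Matrix.one_apply]

/-- `|det (1 + Dc) - 1 - div c| ≤ C κ^2`, with `C` depending only on `d` and `K`. -/
theorem exists_jacobian_bound (d : ℕ) (K : ℝ) : ∃ C, 0 ≤ C ∧ ∀ (m : ℕ) (κ : ℝ) (c : 𝕍 d → 𝕍 d),
    JumpField m K κ c → ∀ x, |(ContinuousLinearMap.id ℝ (𝕍 d) + fderiv ℝ c x).det - 1
      - divergence c x| ≤ C * κ ^ 2 := by
  obtain ⟨C, hC0, hC⟩ := exists_det_bound d K
  refine ⟨C, hC0, fun m κ c h x => ?_⟩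
  rw [h.det_eq]
  exact hC (fun i j => partialD j (fun y => c y i) x) κ h.le
    fun i j => ((h.derivBound i).2.2 j).abs_le x

end Geometry

/-! ### Multiplication and composition operators on `L_2` -/

section Operators

variable {d : ℕ}

/-- `Φ` is a linear operation on functions that induces a bounded operator on `L_2(ℝ^d)` of norm at
most `M`. -/
structure IsL2Op (Φ : (𝕍 d → ℝ) → 𝕍 d → ℝ) (M : ℝ) : Prop where
  nonneg : 0 ≤ M
  aesm : ∀ f, AEStronglyMeasurable f volume → AEStronglyMeasurable (Φ f) volume
  congr : ∀ f g, f =ᵐ[volume] g → Φ f =ᵐ[volume] Φ g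
  add : ∀ f g, Φ (f + g) = Φ f + Φ g
  smul : ∀ (r : ℝ) f, Φ (r • f) = r • Φ f
  bound : ∀ f, AEStronglyMeasurable f volume →
    eLpNorm (Φ f) 2 volume ≤ ENNReal.ofReal M * eLpNorm f 2 volume

theorem IsL2Op.memLp {Φ : (𝕍 d → ℝ) → 𝕍 d → ℝ} {M : ℝ} (h : IsL2Op Φ M) {f : 𝕍 d → ℝ}
    (hf : MemLp f 2 volume) : MemLp (Φ f) 2 volume :=
  ⟨h.aesm f hf.1, (h.bound f hf.1).trans_lt (ENNReal.mul_lt_top ENNReal.ofReal_lt_top hf.2)⟩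

open Classical in
/-- The bounded operator on `L_2(ℝ^d)` induced by an operation on functions
(with the value `0` if there is none). -/
noncomputable def liftL2 (Φ : (𝕍 d → ℝ) → 𝕍 d → ℝ) : L2 d →L[ℝ] L2 d :=
  if h : ∃ M, IsL2Op Φ M then
    LinearMap.mkContinuous
      { toFun := fun f => (h.choose_spec.memLp (Lp.memLp f)).toLp _
        map_add' := fun f g => by
          rw [← MemLp.toLp_add]
          refine MemLp.toLp_congr _ _ ?_
          rw [← h.choose_spec.add]
          exact h.choose_spec.congr _ _ (Lp.coeFn_add f g)
        map_smul' := fun r f => by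
          rw [RingHom.id_apply, ← MemLp.toLp_const_smul]
          refine MemLp.toLp_congr _ _ ?_
          rw [← h.choose_spec.smul]
          exact h.choose_spec.congr _ _ (Lp.coeFn_smul r f) }
      h.choose fun f => by
        change ‖(h.choose_spec.memLp (Lp.memLp f)).toLp _‖ ≤ _
        rw [Lp.norm_toLp, Lp.norm_def]
        refine (ENNReal.toReal_mono ?_ (h.choose_spec.bound f (Lp.memLp f).1)).trans_eq ?_
        · exact ENNReal.mul_ne_top ENNReal.ofReal_ne_top (Lp.eLpNorm_ne_top f)
        · rw [ENNReal.toReal_mul, ENNReal.toReal_ofReal h.choose_spec.nonneg]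
  else 0

theorem IsL2Op.coe_liftL2 {Φ : (𝕍 d → ℝ) → 𝕍 d → ℝ} {M : ℝ} (h : IsL2Op Φ M) (f : L2 d) :
    liftL2 Φ f =ᵐ[volume] Φ f := by
  have h' : ∃ M, IsL2Op Φ M := ⟨M, h⟩
  rw [liftL2, dif_pos h']
  exact (h.memLp (Lp.memLp f)).coeFn_toLp

theorem IsL2Op.norm_liftL2_le {Φ : (𝕍 d → ℝ) → 𝕍 d → ℝ} {M : ℝ} (h : IsL2Op Φ M) (f : L2 d) :
    ‖liftL2 Φ f‖ ≤ M * ‖f‖ := by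
  rw [Lp.norm_def, Lp.norm_def, eLpNorm_congr_ae (h.coe_liftL2 f)]
  refine (ENNReal.toReal_mono ?_ (h.bound f (Lp.memLp f).1)).trans_eq ?_
  · exact ENNReal.mul_ne_top ENNReal.ofReal_ne_top (Lp.eLpNorm_ne_top f)
  · rw [ENNReal.toReal_mul, ENNReal.toReal_ofReal h.nonneg]

/-- Multiplication by the bounded continuous function `b`, as an operator on `L_2(ℝ^d)`. -/
noncomputable def mulOp (b : 𝕍 d → ℝ) : L2 d →L[ℝ] L2 d := liftL2 fun f x => b x * f x

/-- Composition with `x ↦ x + c(x)`, as an operator on `L_2(ℝ^d)`. -/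
noncomputable def compOp (c : 𝕍 d → 𝕍 d) : L2 d →L[ℝ] L2 d := liftL2 fun f x => f (x + c x)

theorem isL2Op_mul {b : 𝕍 d → ℝ} {M : ℝ} (hb : Continuous b) (hM : ∀ x, |b x| ≤ M) :
    IsL2Op (fun f x => b x * f x) M where
  nonneg := (abs_nonneg _).trans (hM 0)
  aesm f hf := hb.aestronglyMeasurable.mul hf
  congr f g h := by filter_upwards [h] with x hx; rw [hx]
  add f g := by funext x; simp [mul_add]
  smul r f := by funext x; simp only [Pi.smul_apply, smul_eq_mul]; ring
  bound f _ := eLpNorm_le_mul_eLpNorm_of_ae_le_mul (ae_of_all _ fun x => by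
    rw [norm_mul]; exact mul_le_mul_of_nonneg_right (hM x) (norm_nonneg _)) 2

variable {b : 𝕍 d → ℝ} {M : ℝ}

theorem coe_mulOp (hb : Continuous b) (hM : ∀ x, |b x| ≤ M) (f : L2 d) :
    mulOp b f =ᵐ[volume] fun x => b x * f x :=
  (isL2Op_mul hb hM).coe_liftL2 f

theorem norm_mulOp_le (hb : Continuous b) (hM : ∀ x, |b x| ≤ M) (f : L2 d) :
    ‖mulOp b f‖ ≤ M * ‖f‖ :=
  (isL2Op_mul hb hM).norm_liftL2_le f

theorem DerivBound.coe_mulOp {k : ℕ} (h : DerivBound k M b) (f : L2 d) :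
    mulOp b f =ᵐ[volume] fun x => b x * f x :=
  _root_.coe_mulOp h.continuous h.abs_le f

theorem DerivBound.norm_mulOp_le {k : ℕ} (h : DerivBound k M b) (f : L2 d) :
    ‖mulOp b f‖ ≤ M * ‖f‖ :=
  _root_.norm_mulOp_le h.continuous h.abs_le f

theorem DerivBound.mulOp_mulOp {k l : ℕ} {M' : ℝ} {b' : 𝕍 d → ℝ} (h : DerivBound k M b)
    (h' : DerivBound l M' b') (f : L2 d) :
    mulOp b (mulOp b' f) = mulOp (fun x => b x * b' x) f := by
  have h0 := (h.of_le (Nat.zero_le _)).mul (h'.of_le (Nat.zero_le _))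
  refine Lp.ext ?_
  filter_upwards [h.coe_mulOp (mulOp b' f), h'.coe_mulOp f, h0.coe_mulOp f] with x h1 h2 h3
  rw [h1, h2, h3, mul_assoc]

variable {m : ℕ} {K κ : ℝ} {c : 𝕍 d → 𝕍 d}

theorem JumpField.isL2Op (h : JumpField m K κ c) (hK : 0 < K) :
    IsL2Op (fun f x => f (x + c x)) K where
  nonneg := hK.le
  aesm f hf := hf.comp_quasiMeasurePreserving (h.quasiMeasurePreserving hK)
  congr f g hfg := (h.quasiMeasurePreserving hK).ae_eq_comp hfg
  add f g := rfl
  smul r f := rfl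
  bound f _ := by
    have h1 : eLpNorm (fun x => f (x + c x)) 2 volume ^ 2
        ≤ (ENNReal.ofReal K * eLpNorm f 2 volume) ^ 2 := by
      rw [mul_pow, eLpNorm_two_sq, eLpNorm_two_sq]
      refine (h.lintegral_comp_le hK fun x => ‖f x‖ₑ ^ 2).trans ?_
      gcongr
      exact le_self_pow₀ (by rw [ENNReal.one_le_ofReal]; exact h.one_le hK) (by norm_num)
    exact (ENNReal.pow_le_pow_left_iff (by norm_num)).1 h1

theorem JumpField.coe_compOp (h : JumpField m K κ c) (hK : 0 < K) (f : L2 d) :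
    compOp c f =ᵐ[volume] fun x => f (x + c x) :=
  (h.isL2Op hK).coe_liftL2 f

theorem JumpField.norm_compOp_le (h : JumpField m K κ c) (hK : 0 < K) (f : L2 d) :
    ‖compOp c f‖ ≤ K * ‖f‖ :=
  (h.isL2Op hK).norm_liftL2_le f

/-! ### Product and chain rules for weak derivatives -/

/-- The product rule. -/
theorem HasPartial.mulOp {f : L2 d} {g : Fin d → L2 d} (h : ∀ i, HasPartial i f (g i))
    (hb : DerivBound 1 M b) (i : Fin d) :
    HasPartial i (mulOp b f) (mulOp (partialD i b) f + mulOp b (g i)) := by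
  refine gradient_induction (P := fun f g => HasPartial i (_root_.mulOp b f)
    (_root_.mulOp (partialD i b) f + _root_.mulOp b (g i)))
    (isClosed_hasPartial i (by fun_prop) (by fun_prop)) (fun φ f g hφ => ?_) h
  have hr : IsC1Rep (fun x => b x * φ x) (_root_.mulOp b f)
      (fun i => _root_.mulOp (partialD i b) f + _root_.mulOp b (g i)) := by
    refine ⟨hb.1.mul hφ.contDiff, ?_, fun i => ?_⟩
    · filter_upwards [hb.coe_mulOp f, hφ.coe_eq] with x h1 h2
      rw [h1, h2]
    · filter_upwards [hb.coe_mulOp (g i), (hb.2.2 i).coe_mulOp f, hφ.coe_eq, hφ.coe_partial i,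
        Lp.coeFn_add (_root_.mulOp (partialD i b) f) (_root_.mulOp b (g i))] with x h1 h2 h3 h4 h5
      rw [h5, Pi.add_apply, h1, h2, h3, h4, partialD_mul hb.1 hφ.contDiff]
  exact hr.hasPartial i

theorem JumpField.partialD_comp (h : JumpField m K κ c) {φ : 𝕍 d → ℝ} (hφ : ContDiff ℝ 1 φ)
    (i : Fin d) (x : 𝕍 d) : partialD i (fun x => φ (x + c x)) x = partialD i φ (x + c x)
      + ∑ j, partialD i (fun y => c y j) x * partialD j φ (x + c x) := by
  have h1 := (hφ.differentiable one_ne_zero (x + c x)).hasFDerivAt.comp x (h.hasFDerivAt x)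
  have h2 : fderiv ℝ (fun x => φ (x + c x)) x
      = (fderiv ℝ φ (x + c x)).comp (ContinuousLinearMap.id ℝ (𝕍 d) + fderiv ℝ c x) := h1.fderiv
  have h3 : ∀ v : 𝕍 d, fderiv ℝ φ (x + c x) v
      = ∑ j, v j * fderiv ℝ φ (x + c x) (EuclideanSpace.single j 1) := by
    intro v
    conv_lhs => rw [eq_sum_smul_single v]
    simp only [map_sum, map_smul, smul_eq_mul]
  conv_lhs => unfold partialD
  rw [h2, ContinuousLinearMap.comp_apply, add_apply, map_add, h3 (fderiv ℝ c x _)]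
  simp_rw [partialD_component h.contDiff]
  rfl

/-- The chain rule for the composition with `x ↦ x + c(x)`. -/
theorem HasPartial.compOp {f : L2 d} {g : Fin d → L2 d} (h : ∀ i, HasPartial i f (g i))
    (hc : JumpField m K κ c) (hK : 0 < K) (i : Fin d) :
    HasPartial i (compOp c f)
      (compOp c (g i) + ∑ j, _root_.mulOp (partialD i fun x => c x j) (compOp c (g j))) := by
  refine gradient_induction (P := fun f g => HasPartial i (_root_.compOp c f)
    (_root_.compOp c (g i) +
      ∑ j, _root_.mulOp (partialD i fun x => c x j) (_root_.compOp c (g j))))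
    (isClosed_hasPartial i (by fun_prop) (by fun_prop)) (fun φ f g hφ => ?_) h
  have hr : IsC1Rep (fun x => φ (x + c x)) (_root_.compOp c f)
      (fun i => _root_.compOp c (g i) +
        ∑ j, _root_.mulOp (partialD i fun x => c x j) (_root_.compOp c (g j))) := by
    refine ⟨hφ.contDiff.comp (contDiff_id.add hc.contDiff), ?_, fun i => ?_⟩
    · filter_upwards [hc.coe_compOp hK f,
        (hc.quasiMeasurePreserving hK).ae_eq_comp hφ.coe_eq] with x h1 h2
      rw [h1]; exact h2
    · have h1 : ∀ᵐ x, ∀ j, _root_.mulOp (partialD i fun x => c x j) (_root_.compOp c (g j)) x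
          = partialD i (fun x => c x j) x * partialD j φ (x + c x) := by
        rw [ae_all_iff]
        intro j
        filter_upwards [((hc.derivBound j).2.2 i).coe_mulOp (_root_.compOp c (g j)),
          hc.coe_compOp hK (g j),
          (hc.quasiMeasurePreserving hK).ae_eq_comp (hφ.coe_partial j)] with x h1 h2 h3
        rw [h1, h2]; congr 1
      filter_upwards [h1, hc.coe_compOp hK (g i),
        (hc.quasiMeasurePreserving hK).ae_eq_comp (hφ.coe_partial i),
        Lp.coeFn_add (_root_.compOp c (g i))
          (∑ j, _root_.mulOp (partialD i fun x => c x j) (_root_.compOp c (g j))),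
        Lp.coeFn_finsetSum Finset.univ
          fun j => _root_.mulOp (partialD i fun x => c x j) (_root_.compOp c (g j))]
        with x h1 h2 h3 h4 h5
      rw [h4, Pi.add_apply, h2, h5, hc.partialD_comp hφ.contDiff]
      congr 1
      simp [h1]
  exact hr.hasPartial i

/-! ### Bilinear estimates for the composition operator -/

theorem DerivBound.abs_sub_le (hb : DerivBound 1 M b) (x y : 𝕍 d) :
    |b x - b y| ≤ d * M * ‖x - y‖ := by
  refine Convex.norm_image_sub_le_of_norm_fderiv_le (𝕜 := ℝ) (f := b) (s := Set.univ)
    (fun x _ => hb.1.differentiable one_ne_zero x) (fun z _ => ?_) convex_univ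
    (Set.mem_univ y) (Set.mem_univ x)
  refine ContinuousLinearMap.opNorm_le_bound _ (mul_nonneg (Nat.cast_nonneg _) hb.nonneg)
    fun v => ?_
  calc ‖fderiv ℝ b z v‖ = ‖∑ j, v j • fderiv ℝ b z (EuclideanSpace.single j (1 : ℝ))‖ := by
        conv_lhs => rw [eq_sum_smul_single v]
        simp only [map_sum, map_smul]
    _ ≤ ∑ j, ‖v j • fderiv ℝ b z (EuclideanSpace.single j (1 : ℝ))‖ := norm_sum_le _ _
    _ ≤ ∑ _j : Fin d, ‖v‖ * M := by
        refine Finset.sum_le_sum fun j _ => ?_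
        rw [norm_smul]
        exact mul_le_mul (abs_apply_le_norm v j) ((hb.2.2 j).2 z) (norm_nonneg _) (norm_nonneg _)
    _ = d * M * ‖v‖ := by simp; ring

theorem inner_mulOp_eq (hb : Continuous b) (hM : ∀ x, |b x| ≤ M) (f g : L2 d) :
    inner ℝ f (mulOp b g) = ∫ x, b x * (f x * g x) := by
  rw [L2_inner_eq]
  refine integral_congr_ae ?_
  filter_upwards [coe_mulOp hb hM g] with x hx
  rw [hx]; ring

theorem abs_inner_mulOp_le (hb : Continuous b) (hM : ∀ x, |b x| ≤ M) (f g : L2 d) :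
    |inner ℝ f (mulOp b g)| ≤ M * (‖f‖ * ‖g‖) := by
  refine (abs_real_inner_le_norm _ _).trans ?_
  calc ‖f‖ * ‖mulOp b g‖ ≤ ‖f‖ * (M * ‖g‖) := by gcongr; exact norm_mulOp_le hb hM g
    _ = M * (‖f‖ * ‖g‖) := by ring

theorem mulOp_sub {b' : 𝕍 d → ℝ} {M' : ℝ} (hb : Continuous b) (hM : ∀ x, |b x| ≤ M)
    (hb' : Continuous b') (hM' : ∀ x, |b' x| ≤ M') (f : L2 d) :
    mulOp (fun x => b x - b' x) f = mulOp b f - mulOp b' f := by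
  have h0 : ∀ x, |b x - b' x| ≤ M + M' :=
    fun x => (abs_sub _ _).trans (add_le_add (hM x) (hM' x))
  have hc : Continuous fun x => b x - b' x := hb.sub hb'
  refine Lp.ext ?_
  filter_upwards [coe_mulOp hb hM f, coe_mulOp hb' hM' f, coe_mulOp hc h0 f,
    Lp.coeFn_sub (mulOp b f) (mulOp b' f)] with x h1 h2 h3 h4
  rw [h4, Pi.sub_apply, h1, h2, h3]; ring

theorem JumpField.continuous_det (h : JumpField m K κ c) :
    Continuous fun x => (ContinuousLinearMap.id ℝ (𝕍 d) + fderiv ℝ c x).det :=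
  ContinuousLinearMap.continuous_det.comp
    (continuous_const.add (h.contDiff.continuous_fderiv one_ne_zero))

/-- The change of variables formula for `(f, b g)_0`. -/
theorem JumpField.inner_mulOp_comp (h : JumpField m K κ c) (hK : 0 < K) (hb : Continuous b)
    (hM : ∀ x, |b x| ≤ M) {J : ℝ}
    (hJ : ∀ x, |(ContinuousLinearMap.id ℝ (𝕍 d) + fderiv ℝ c x).det| ≤ J) (f g : L2 d) :
    inner ℝ f (mulOp b g) = inner ℝ (compOp c f)
      (mulOp (fun x => (ContinuousLinearMap.id ℝ (𝕍 d) + fderiv ℝ c x).det * b (x + c x))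
        (compOp c g)) := by
  have hJ0 : 0 ≤ J := (abs_nonneg _).trans (hJ 0)
  rw [inner_mulOp_eq hb hM, h.integral_comp hK, inner_mulOp_eq (M := J * M)]
  · refine integral_congr_ae ?_
    filter_upwards [h.coe_compOp hK f, h.coe_compOp hK g] with x h1 h2
    rw [h1, h2]; ring
  · exact h.continuous_det.mul (hb.comp (continuous_id.add h.contDiff.continuous))
  · intro x
    rw [abs_mul]
    exact mul_le_mul (hJ x) (hM _) (abs_nonneg _) hJ0

theorem DerivBound.sum {ι : Type*} (s : Finset ι) {k : ℕ} {b : ι → 𝕍 d → ℝ}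
    (h : ∀ a, DerivBound k M (b a)) : DerivBound k (s.card * M) (fun x => ∑ a ∈ s, b a x) := by
  classical
  induction s using Finset.induction_on with
  | empty =>
    simp only [Finset.card_empty, Nat.cast_zero, zero_mul, Finset.sum_empty]
    induction k with
    | zero => exact ⟨continuous_const, by simp⟩
    | succ k ih =>
      refine ⟨contDiff_const, by simp, fun i => ?_⟩
      have : partialD i (fun _ : 𝕍 d => (0 : ℝ)) = fun _ => 0 := by
        funext x; simp [partialD]
      rw [this]
      exact ih fun a => (h a).of_succ
  | insert a s ha ih =>
    simp_rw [Finset.sum_insert ha]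
    rw [Finset.card_insert_of_notMem ha]
    push_cast
    rw [show ((s.card : ℝ) + 1) * M = M + s.card * M by ring]
    exact (h a).add ih

theorem JumpField.derivBound_divergence (h : JumpField m K κ c) :
    DerivBound m (d * κ) (divergence c) := by
  have := DerivBound.sum (Finset.univ : Finset (Fin d))
    (b := fun i => partialD i fun y => c y i) (fun i => (h.derivBound i).2.2 i)
  rw [Finset.card_univ, Fintype.card_fin] at this
  exact this

/-- Bounds for the Jacobian determinant. -/
theorem exists_jacobian_bounds (d : ℕ) (K : ℝ) : ∃ J, 0 ≤ J ∧ ∀ (m : ℕ) (κ : ℝ) (c : 𝕍 d → 𝕍 d),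
    JumpField m K κ c → ∀ x,
      |(ContinuousLinearMap.id ℝ (𝕍 d) + fderiv ℝ c x).det - 1 - divergence c x| ≤ J * κ ^ 2 ∧
      |(ContinuousLinearMap.id ℝ (𝕍 d) + fderiv ℝ c x).det - 1| ≤ J * κ ∧
      |(ContinuousLinearMap.id ℝ (𝕍 d) + fderiv ℝ c x).det| ≤ J := by
  obtain ⟨C, hC0, hC⟩ := exists_jacobian_bound d K
  refine ⟨C + (d + C * |K|) + (1 + (d + C * |K|) * |K|), by positivity, fun m κ c h x => ?_⟩
  have hκ := h.nonneg
  have hκK : κ ≤ |K| := h.le.trans (le_abs_self K)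
  have h1 := hC m κ c h x
  have h2 := h.derivBound_divergence.abs_le x
  set D := (ContinuousLinearMap.id ℝ (𝕍 d) + fderiv ℝ c x).det
  have h3 : |D - 1| ≤ (d + C * |K|) * κ := by
    have e : D - 1 = (D - 1 - divergence c x) + divergence c x := by ring
    rw [e]
    refine (abs_add_le _ _).trans ((add_le_add h1 h2).trans ?_)
    nlinarith [mul_le_mul_of_nonneg_left hκK (mul_nonneg hC0 hκ)]
  have h4 : |D| ≤ 1 + (d + C * |K|) * |K| := by
    have e : D = 1 + (D - 1) := by ring
    rw [e]
    refine (abs_add_le _ _).trans ?_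
    rw [abs_one]
    have : (d + C * |K|) * κ ≤ (d + C * |K|) * |K| := by gcongr
    linarith
  have p1 : 0 ≤ (d + C * |K|) := by positivity
  have p2 : 0 ≤ 1 + (d + C * |K|) * |K| := by positivity
  refine ⟨h1.trans ?_, h3.trans ?_, h4.trans ?_⟩
  · exact mul_le_mul_of_nonneg_right (by linarith) (by positivity)
  · exact mul_le_mul_of_nonneg_right (by linarith) hκ
  · linarith

/-- Replacing `f`, `g` by their compositions with `x + c(x)` changes `(f, b g)_0` by `O(κ)`: after
a change of variables the difference has the coefficient `b(x) - det (1 + Dc(x)) b(x + c(x))`. -/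
theorem exists_inner_mulOp_compOp_bound (d : ℕ) {K : ℝ} (hK : 0 < K) : ∃ C, 0 ≤ C ∧
    ∀ (m : ℕ) (κ : ℝ) (c : 𝕍 d → 𝕍 d), JumpField m K κ c →
    ∀ (M : ℝ) (b : 𝕍 d → ℝ), DerivBound 1 M b → ∀ f g : L2 d,
      |inner ℝ (compOp c f) (mulOp b (compOp c g)) - inner ℝ f (mulOp b g)|
        ≤ C * (M * κ) * (‖f‖ * ‖g‖) := by
  obtain ⟨J, hJ0, hJ⟩ := exists_jacobian_bounds d K
  refine ⟨(d + J) * (K * K), by positivity, fun m κ c h M b hb f g => ?_⟩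
  have hκ := h.nonneg
  have hM := hb.nonneg
  have hJ3 := fun x => (hJ m κ c h x).2.2
  have hc : Continuous fun x =>
      (ContinuousLinearMap.id ℝ (𝕍 d) + fderiv ℝ c x).det * b (x + c x) :=
    h.continuous_det.mul (hb.continuous.comp (continuous_id.add h.contDiff.continuous))
  rw [h.inner_mulOp_comp hK hb.continuous hb.abs_le hJ3 f g, ← inner_sub_right,
    ← mulOp_sub hb.continuous hb.abs_le hc (M' := J * M) fun x => by
      rw [abs_mul]; exact mul_le_mul (hJ3 x) (hb.abs_le _) (abs_nonneg _) hJ0]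
  have hbc : Continuous fun x => b x -
      (ContinuousLinearMap.id ℝ (𝕍 d) + fderiv ℝ c x).det * b (x + c x) := hb.continuous.sub hc
  refine (abs_inner_mulOp_le hbc (M := (d + J) * (M * κ)) (fun x => ?_)
    _ _).trans ?_
  · set D := (ContinuousLinearMap.id ℝ (𝕍 d) + fderiv ℝ c x).det with hD
    have e : b x - D * b (x + c x) = (b x - b (x + c x)) - (D - 1) * b (x + c x) := by ring
    rw [e]
    refine (abs_sub _ _).trans ?_
    have e1 : |b x - b (x + c x)| ≤ d * M * κ := by
      refine (hb.abs_sub_le x (x + c x)).trans ?_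
      have : ‖x - (x + c x)‖ ≤ κ := by simpa using h.norm_le x
      gcongr
    have e2 : |(D - 1) * b (x + c x)| ≤ J * κ * M := by
      rw [abs_mul]
      exact mul_le_mul (hJ m κ c h x).2.1 (hb.abs_le _) (abs_nonneg _) (by positivity)
    linarith
  · calc (d + J) * (M * κ) * (‖compOp c f‖ * ‖compOp c g‖)
        ≤ (d + J) * (M * κ) * ((K * ‖f‖) * (K * ‖g‖)) := by
          gcongr
          · exact h.norm_compOp_le hK f
          · exact h.norm_compOp_le hK g
      _ = _ := by ring

/-- `‖f(· + c)‖_0^2 = ‖f‖_0^2 - (f, (div c) f)_0 + O(κ^2)`. -/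
theorem exists_norm_compOp_sq_bound (d : ℕ) {K : ℝ} (hK : 0 < K) : ∃ C, 0 ≤ C ∧
    ∀ (m : ℕ) (κ : ℝ) (c : 𝕍 d → 𝕍 d), 1 ≤ m → JumpField m K κ c → ∀ f : L2 d,
      |‖compOp c f‖ ^ 2 - ‖f‖ ^ 2 + inner ℝ f (mulOp (divergence c) f)| ≤ C * κ ^ 2 * ‖f‖ ^ 2 := by
  obtain ⟨J, hJ0, hJ⟩ := exists_jacobian_bounds d K
  refine ⟨(d * d + J + J * d) * (K * K), by positivity, fun m κ c hm h f => ?_⟩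
  have hκ := h.nonneg
  have hb : DerivBound 1 (d * κ) (divergence c) := h.derivBound_divergence.of_le hm
  have hJ3 := fun x => (hJ m κ c h x).2.2
  set D := fun x => (ContinuousLinearMap.id ℝ (𝕍 d) + fderiv ℝ c x).det with hD
  have hc : Continuous fun x => D x * divergence c (x + c x) :=
    h.continuous_det.mul (hb.continuous.comp (continuous_id.add h.contDiff.continuous))
  have hcb : ∀ x, |D x * divergence c (x + c x)| ≤ J * (d * κ) := fun x => by
    rw [abs_mul]; exact mul_le_mul (hJ3 x) (hb.abs_le _) (abs_nonneg _) hJ0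
  have one : ∀ f : L2 d, ‖f‖ ^ 2 = inner ℝ f (mulOp (fun _ => 1) f) := fun f => by
    rw [inner_mulOp_eq continuous_const (M := 1) (by simp), ← real_inner_self_eq_norm_sq,
      L2_inner_eq]
    simp
  have e1 : ‖f‖ ^ 2 = inner ℝ (compOp c f) (mulOp D (compOp c f)) := by
    rw [one, h.inner_mulOp_comp hK continuous_const (M := 1) (by simp) hJ3]
    simp [hD]
  have hDb : ∀ x, |D x - D x * divergence c (x + c x)| ≤ J + J * (d * κ) := fun x =>
    (abs_sub _ _).trans (add_le_add (hJ3 x) (hcb x))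
  have hdc : Continuous fun x => D x - D x * divergence c (x + c x) := h.continuous_det.sub hc
  -- After the change of variables all three terms have the form `(T f, w T f)_0`.
  have e2 : ‖compOp c f‖ ^ 2 - ‖f‖ ^ 2 + inner ℝ f (mulOp (divergence c) f)
      = inner ℝ (compOp c f) (mulOp (fun x => 1 - (D x - D x * divergence c (x + c x)))
        (compOp c f)) := by
    rw [one (compOp c f), e1, h.inner_mulOp_comp hK hb.continuous hb.abs_le hJ3,
      mulOp_sub continuous_const (M := 1) (by simp) hdc hDb,
      mulOp_sub h.continuous_det hJ3 hc hcb, inner_sub_right, inner_sub_right]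
    ring
  have h1c : Continuous fun x => 1 - (D x - D x * divergence c (x + c x)) :=
    continuous_const.sub hdc
  rw [e2]
  refine (abs_inner_mulOp_le h1c (M := (d * d + J + J * d) * κ ^ 2)
    (fun x => ?_) _ _).trans ?_
  · have e : 1 - (D x - D x * divergence c (x + c x))
      = -(D x - 1 - divergence c x) + ((D x - 1) * divergence c (x + c x)
        - (divergence c x - divergence c (x + c x))) := by ring
    rw [e]
    have t1 : |-(D x - 1 - divergence c x)| ≤ J * κ ^ 2 := by
      rw [abs_neg]; exact (hJ m κ c h x).1
    have t2 : |(D x - 1) * divergence c (x + c x)| ≤ J * κ * (d * κ) := by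
      rw [abs_mul]
      exact mul_le_mul (hJ m κ c h x).2.1 (hb.abs_le _) (abs_nonneg _) (by positivity)
    have t3 : |divergence c x - divergence c (x + c x)| ≤ d * (d * κ) * κ := by
      refine (hb.abs_sub_le x (x + c x)).trans ?_
      have : ‖x - (x + c x)‖ ≤ κ := by simpa using h.norm_le x
      gcongr
    refine (abs_add_le _ _).trans ((add_le_add t1 ((abs_sub _ _).trans (add_le_add t2 t3))).trans
      (le_of_eq (by ring)))
  · calc (d * d + J + J * d) * κ ^ 2 * (‖compOp c f‖ * ‖compOp c f‖)
        ≤ (d * d + J + J * d) * κ ^ 2 * ((K * ‖f‖) * (K * ‖f‖)) := by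
          gcongr <;> exact h.norm_compOp_le hK f
      _ = _ := by ring

end Operators

/-! ### Taylor estimates for `u(x + c(x))` -/

section Taylor

variable {d m : ℕ} {K κ : ℝ} {c : 𝕍 d → 𝕍 d}

theorem enorm_sub_sq_le_lintegral {h h' : ℝ → ℝ} (hd : ∀ t, HasDerivAt h (h' t) t)
    (hc : Continuous h') : ‖h 1 - h 0‖ₑ ^ 2 ≤ ∫⁻ t in Set.Ioc (0 : ℝ) 1, ‖h' t‖ₑ ^ 2 := by
  have : IsProbabilityMeasure (volume.restrict (Set.Ioc (0 : ℝ) 1)) := ⟨by simp⟩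
  rw [← intervalIntegral.integral_eq_sub_of_hasDerivAt (fun t _ => hd t)
    (hc.intervalIntegrable _ _), intervalIntegral.integral_of_le zero_le_one]
  exact enorm_integral_sq_le hc.aestronglyMeasurable

/-- The first-order Taylor formula in integral form, squared. The numbers `a j` are arbitrary
approximations of the gradient along the segment from `x` to `x + v`. -/
theorem enorm_taylor_sq_le {φ : 𝕍 d → ℝ} (hφ : ContDiff ℝ 1 φ) (x v : 𝕍 d) {κ : ℝ}
    (hv : ‖v‖ ≤ κ) (a : Fin d → ℝ) :
    ‖φ (x + v) - φ x - ∑ j, v j * a j‖ₑ ^ 2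
      ≤ ENNReal.ofReal (κ ^ 2) * ∑ j, ∫⁻ t in Set.Ioc (0 : ℝ) 1,
        ‖partialD j φ (x + t • v) - a j‖ₑ ^ 2 := by
  have hsum : ∀ w y : 𝕍 d, fderiv ℝ φ y w = ∑ j, w j * partialD j φ y := by
    intro w y
    conv_lhs => rw [eq_sum_smul_single w]
    simp only [map_sum, map_smul, smul_eq_mul]
    rfl
  let h : ℝ → ℝ := fun t => φ (x + t • v) - t * ∑ j, v j * a j
  let h' : ℝ → ℝ := fun t => ∑ j, v j * (partialD j φ (x + t • v) - a j)
  have hd : ∀ t, HasDerivAt h (h' t) t := by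
    intro t
    have h1 : HasDerivAt (fun t : ℝ => x + t • v) v t := by
      simpa using ((hasDerivAt_id t).smul_const v).const_add x
    have h2 : HasDerivAt (fun t : ℝ => φ (x + t • v)) (fderiv ℝ φ (x + t • v) v) t :=
      (hφ.differentiable one_ne_zero _).hasFDerivAt.comp_hasDerivAt t h1
    have h3 := h2.sub ((hasDerivAt_id t).mul_const (∑ j, v j * a j))
    have e : h' t = fderiv ℝ φ (x + t • v) v - 1 * ∑ j, v j * a j := by
      simp only [h', mul_sub, Finset.sum_sub_distrib, hsum, one_mul]
    rw [e]
    exact h3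
  have hcont : ∀ j, Continuous fun t : ℝ => partialD j φ (x + t • v) := fun j =>
    (partialD_continuous hφ).comp (by fun_prop)
  have hc : Continuous h' := continuous_finsetSum _ fun j _ =>
    continuous_const.mul ((hcont j).sub continuous_const)
  have e : φ (x + v) - φ x - ∑ j, v j * a j = h 1 - h 0 := by
    simp only [h]; simp; ring
  rw [e]
  refine (enorm_sub_sq_le_lintegral hd hc).trans ?_
  rw [← lintegral_finsetSum _ fun j _ => by
    exact (((hcont j).sub continuous_const).measurable.enorm.pow_const 2)]
  rw [← lintegral_const_mul' _ _ ENNReal.ofReal_ne_top]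
  refine lintegral_mono fun t => ?_
  have en : ∀ y : ℝ, ‖y‖ₑ ^ 2 = ENNReal.ofReal (y ^ 2) := fun y => by
    rw [← ofReal_norm, ← ENNReal.ofReal_pow (norm_nonneg _), Real.norm_eq_abs, sq_abs]
  simp only [en]
  rw [← ENNReal.ofReal_sum_of_nonneg fun _ _ => sq_nonneg _,
    ← ENNReal.ofReal_mul (sq_nonneg _)]
  refine ENNReal.ofReal_le_ofReal ((Finset.sum_mul_sq_le_sq_mul_sq _ _ _).trans ?_)
  refine mul_le_mul_of_nonneg_right ?_ (Finset.sum_nonneg fun _ _ => sq_nonneg _)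
  have : ∑ j, v j ^ 2 = ‖v‖ ^ 2 := by
    rw [EuclideanSpace.norm_sq_eq]; simp
  rw [this]
  gcongr

theorem L2_enorm_sq (f : L2 d) : ‖f‖ₑ ^ 2 = ∫⁻ x, ‖f x‖ₑ ^ 2 := by
  rw [Lp.enorm_def, eLpNorm_two_sq]

theorem coe_sum_mulOp (h : JumpField m K κ c) (g : Fin d → L2 d) :
    ⇑(∑ j, mulOp (fun x => c x j) (g j)) =ᵐ[volume] fun x => ∑ j, c x j * g j x := by
  have h1 : ∀ᵐ x, ∀ j, mulOp (fun x => c x j) (g j) x = c x j * g j x := by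
    rw [ae_all_iff]
    exact fun j => (h.derivBound j).coe_mulOp (g j)
  filter_upwards [h1, Lp.coeFn_finsetSum Finset.univ fun j => mulOp (fun x => c x j) (g j)]
    with x h1 h2
  rw [h2]
  simp [h1]

/-- The Taylor estimate in `L_2` with `s = 0` (order one) or `s = 1` (order two), in terms of a
bound for the increments of the gradient. -/
theorem JumpField.norm_taylor_le_of_isC1Rep (h : JumpField m K κ c) (hK : 0 < K) {φ : 𝕍 d → ℝ}
    {f : L2 d} {g : Fin d → L2 d} (hφ : IsC1Rep φ f g) (s : ℝ) {B : ℝ}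
    (hB : ∀ t ∈ Set.Icc (0 : ℝ) 1, ∀ j, ‖compOp (fun x => t • c x) (g j) - s • g j‖ ≤ B)
    (hB0 : 0 ≤ B) :
    ‖compOp c f - f - s • ∑ j, mulOp (fun x => c x j) (g j)‖ ≤ κ * (d * B) := by
  have hκ := h.nonneg
  set F : L2 d := compOp c f - f - s • ∑ j, mulOp (fun x => c x j) (g j) with hF
  have hFe : F =ᵐ[volume] fun x => φ (x + c x) - φ x - ∑ j, c x j * (s * partialD j φ x) := by
    have hall : ∀ᵐ x, ∀ j, g j x = partialD j φ x := by
      rw [ae_all_iff]; exact hφ.coe_partial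
    filter_upwards [Lp.coeFn_sub (compOp c f - f) (s • ∑ j, mulOp (fun x => c x j) (g j)),
      Lp.coeFn_sub (compOp c f) f, Lp.coeFn_smul s (∑ j, mulOp (fun x => c x j) (g j)),
      coe_sum_mulOp h g, h.coe_compOp hK f, hφ.coe_eq, hall,
      (h.quasiMeasurePreserving hK).ae_eq_comp hφ.coe_eq] with x h1 h2 h3 h4 h5 h6 h7 h8
    have h8' : f (x + c x) = φ (x + c x) := h8
    rw [h1, Pi.sub_apply, h2, Pi.sub_apply, h3, Pi.smul_apply, h4, h5, h6, h8', smul_eq_mul,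
      Finset.mul_sum]
    congr 1
    exact Finset.sum_congr rfl fun j _ => by rw [h7]; ring
  have hpc : ∀ j, Continuous (partialD j φ) := fun j => partialD_continuous hφ.contDiff
  have hsq : ‖F‖ₑ ^ 2 ≤ ENNReal.ofReal ((κ * (d * B)) ^ 2) := by
    calc ‖F‖ₑ ^ 2 = ∫⁻ x, ‖φ (x + c x) - φ x - ∑ j, c x j * (s * partialD j φ x)‖ₑ ^ 2 := by
          rw [L2_enorm_sq]
          exact lintegral_congr_ae (by filter_upwards [hFe] with x hx; rw [hx])
      _ ≤ ∫⁻ x, ENNReal.ofReal (κ ^ 2) * ∑ j, ∫⁻ t in Set.Ioc (0 : ℝ) 1,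
            ‖partialD j φ (x + t • c x) - s * partialD j φ x‖ₑ ^ 2 :=
          lintegral_mono fun x => enorm_taylor_sq_le hφ.contDiff x (c x) (h.norm_le x) _
      _ = ENNReal.ofReal (κ ^ 2) * ∑ j, ∫⁻ t in Set.Ioc (0 : ℝ) 1, ∫⁻ x,
            ‖partialD j φ (x + t • c x) - s * partialD j φ x‖ₑ ^ 2 := by
          have hm : ∀ j, Measurable fun p : 𝕍 d × ℝ =>
              ‖partialD j φ (p.1 + p.2 • c p.1) - s * partialD j φ p.1‖ₑ ^ 2 := fun j => by
            have : Continuous fun p : 𝕍 d × ℝ =>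
                partialD j φ (p.1 + p.2 • c p.1) - s * partialD j φ p.1 := by
              refine ((hpc j).comp ?_).sub (continuous_const.mul ((hpc j).comp continuous_fst))
              exact continuous_fst.add (continuous_snd.smul
                (h.contDiff.continuous.comp continuous_fst))
            exact this.measurable.enorm.pow_const 2
          rw [lintegral_const_mul' _ _ ENNReal.ofReal_ne_top,
            lintegral_finsetSum _ fun j _ => (hm j).lintegral_prod_right']
          congr 1
          refine Finset.sum_congr rfl fun j _ => ?_
          exact lintegral_lintegral_swap (hm j).aemeasurable
      _ ≤ ENNReal.ofReal (κ ^ 2) * ∑ _j : Fin d, ∫⁻ _t in Set.Ioc (0 : ℝ) 1,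
            ENNReal.ofReal (B ^ 2) := by
          refine mul_le_mul' le_rfl (Finset.sum_le_sum fun j _ => ?_)
          refine setLIntegral_mono measurable_const fun t ht => ?_
          have ht' : t ∈ Set.Icc (0 : ℝ) 1 := Set.Ioc_subset_Icc_self ht
          have hct := h.smul ht'
          have e : ∫⁻ x, ‖partialD j φ (x + t • c x) - s * partialD j φ x‖ₑ ^ 2
              = ‖compOp (fun x => t • c x) (g j) - s • g j‖ₑ ^ 2 := by
            rw [L2_enorm_sq]
            refine lintegral_congr_ae ?_
            filter_upwards [Lp.coeFn_sub (compOp (fun x => t • c x) (g j)) (s • g j),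
              Lp.coeFn_smul s (g j), hct.coe_compOp hK (g j), hφ.coe_partial j,
              (hct.quasiMeasurePreserving hK).ae_eq_comp (hφ.coe_partial j)]
              with x h1 h2 h3 h4 h5
            have h5' : g j (x + t • c x) = partialD j φ (x + t • c x) := h5
            rw [h1, Pi.sub_apply, h2, Pi.smul_apply, h3, h5', h4, smul_eq_mul]
          rw [e, ← ofReal_norm, ← ENNReal.ofReal_pow (norm_nonneg _)]
          refine ENNReal.ofReal_le_ofReal ?_
          have := hB t ht' j
          gcongr
      _ = ENNReal.ofReal (κ ^ 2 * (d * B ^ 2)) := by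
          rw [ENNReal.ofReal_mul (sq_nonneg _), ENNReal.ofReal_mul (Nat.cast_nonneg _)]
          simp
      _ ≤ ENNReal.ofReal ((κ * (d * B)) ^ 2) := by
          refine ENNReal.ofReal_le_ofReal ?_
          have hdd : (d : ℝ) ≤ d ^ 2 := by exact_mod_cast Nat.le_self_pow (by norm_num) d
          calc κ ^ 2 * (d * B ^ 2) ≤ κ ^ 2 * (d ^ 2 * B ^ 2) := by gcongr
            _ = _ := by ring
  rw [← ofReal_norm, ← ENNReal.ofReal_pow (norm_nonneg _),
    ENNReal.ofReal_le_ofReal_iff (by positivity)] at hsq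
  exact (pow_le_pow_iff_left₀ (norm_nonneg _) (by positivity) two_ne_zero).1 hsq

theorem JumpField.norm_taylor_le (h : JumpField m K κ c) (hK : 0 < K)
    {f : L2 d} {g : Fin d → L2 d} (hfg : ∀ i, HasPartial i f (g i)) (s : ℝ) {B : ℝ}
    (hB : ∀ t ∈ Set.Icc (0 : ℝ) 1, ∀ j, ‖compOp (fun x => t • c x) (g j) - s • g j‖ ≤ B)
    (hB0 : 0 ≤ B) :
    ‖compOp c f - f - s • ∑ j, mulOp (fun x => c x j) (g j)‖ ≤ κ * (d * B) := by
  -- The estimate for approximations `(f', g')` has an additional term that vanishes at `g' = g`.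
  have := gradient_induction (f := f) (g := g)
    (P := fun f' g' => ‖compOp c f' - f' - s • ∑ j, mulOp (fun x => c x j) (g' j)‖
      ≤ κ * (d * (B + (K + |s|) * ‖g' - g‖))) (isClosed_le (by fun_prop) (by fun_prop))
    (fun φ f' g' hφ => ?_) hfg
  · simpa using this
  · refine h.norm_taylor_le_of_isC1Rep hK hφ s (fun t ht j => ?_) (by positivity)
    have hj : ‖g' j - g j‖ ≤ ‖g' - g‖ := norm_le_pi_norm (g' - g) j
    have e : compOp (fun x => t • c x) (g' j) - s • g' j
        = (compOp (fun x => t • c x) (g j) - s • g j)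
          + (compOp (fun x => t • c x) (g' j - g j) - s • (g' j - g j)) := by
      rw [map_sub, smul_sub]; abel
    rw [e]
    refine (norm_add_le _ _).trans (add_le_add (hB t ht j) ((norm_sub_le _ _).trans ?_))
    rw [add_mul, norm_smul, Real.norm_eq_abs]
    refine add_le_add (((h.smul ht).norm_compOp_le hK _).trans ?_) ?_
    · gcongr
    · gcongr

/-- `‖f(· + c) - f‖_0 = O(κ)` for `f ∈ H^1`. -/
theorem JumpField.norm_compOp_sub_le (h : JumpField m K κ c) (hK : 0 < K)
    {f : L2 d} {g : Fin d → L2 d} (hfg : ∀ i, HasPartial i f (g i)) {G : ℝ}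
    (hG : ∀ j, ‖g j‖ ≤ G) (hG0 : 0 ≤ G) : ‖compOp c f - f‖ ≤ κ * (d * (K * G)) := by
  have := h.norm_taylor_le hK hfg 0 (B := K * G) (fun t ht j => ?_) (by positivity)
  · simpa using this
  · rw [zero_smul, sub_zero]
    exact ((h.smul ht).norm_compOp_le hK _).trans (mul_le_mul_of_nonneg_left (hG j) hK.le)

/-- `‖f(· + c) - f - c · ∇f‖_0 = O(κ^2)` for `f ∈ H^2`. -/
theorem JumpField.norm_compOp_sub_sub_le (h : JumpField m K κ c) (hK : 0 < K)
    {f : L2 d} {g : Fin d → L2 d} {g₂ : Fin d → Fin d → L2 d}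
    (hfg : ∀ i, HasPartial i f (g i)) (hg : ∀ j i, HasPartial i (g j) (g₂ j i)) {G : ℝ}
    (hG : ∀ j i, ‖g₂ j i‖ ≤ G) (hG0 : 0 ≤ G) :
    ‖compOp c f - f - ∑ j, mulOp (fun x => c x j) (g j)‖ ≤ κ * (d * (κ * (d * (K * G)))) := by
  have hκ := h.nonneg
  have := h.norm_taylor_le hK hfg 1 (B := κ * (d * (K * G))) (fun t ht j => ?_) (by positivity)
  · simpa using this
  · rw [one_smul]
    exact (h.smul ht).norm_compOp_sub_le hK (hg j) (hG j) hG0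

end Taylor

/-! ### Weak derivatives of functions in `H^k` -/

section WeakDerivatives

variable {d : ℕ}

/-- `∂^α ∂_i = ∂^{α + e_i}` on smooth functions. -/
theorem multiD_partialD (α : Fin d → ℕ) (i : Fin d) {φ : 𝕍 d → ℝ} (hφ : ContDiff ℝ ∞ φ) :
    multiD α (partialD i φ) = multiD (α + Pi.single i 1) φ := by
  rw [multiD_eq_wordD, multiD_eq_wordD]
  have h : wordD (multiWord α) (partialD i φ) = wordD (multiWord α ++ [i]) φ := by
    simp [wordD, List.foldr_append]
  rw [h]
  refine wordD_perm ?_ (hφ.of_le (by exact_mod_cast le_top))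
  rw [List.perm_iff_count]
  intro a
  rw [count_multiWord, List.count_append, count_multiWord, List.count_singleton]
  by_cases ha : a = i
  · subst ha; simp
  · simp [ha, Ne.symm ha]

theorem IsWeakDeriv.partial {α : Fin d → ℕ} {u : 𝕍 d → ℝ} {f g : L2 d} {i : Fin d}
    (h : IsWeakDeriv α u f) (hp : HasPartial i f g) : IsWeakDeriv (α + Pi.single i 1) u g := by
  refine ⟨h.1, fun φ hφ hc => ?_⟩
  rw [← multiD_partialD α i hφ, h.2 _ (partialD_smooth i hφ) (partialD_hasCompactSupport i hc),
    hp φ hφ hc, sum_add_single, pow_succ]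
  ring

theorem IsWeakDeriv.hasPartial {α : Fin d → ℕ} {u : 𝕍 d → ℝ} {f g : L2 d} {i : Fin d}
    (h : IsWeakDeriv α u f) (h' : IsWeakDeriv (α + Pi.single i 1) u g) : HasPartial i f g := by
  intro φ hφ hc
  have h1 := h.2 _ (partialD_smooth i hφ) (partialD_hasCompactSupport i hc)
  have h2 := h'.2 φ hφ hc
  rw [multiD_partialD α i hφ, h2, sum_add_single, pow_succ, mul_assoc] at h1
  have h3 := mul_left_cancel₀ (pow_ne_zero _ (by norm_num)) h1
  linarith

theorem IsWeakDeriv.congr {α : Fin d → ℕ} {u u' : 𝕍 d → ℝ} {f : L2 d}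
    (h : IsWeakDeriv α u f) (hu : u =ᵐ[volume] u') : IsWeakDeriv α u' f := by
  refine ⟨h.1.congr hu, fun φ hφ hc => ?_⟩
  rw [← h.2 φ hφ hc]
  exact integral_congr_ae (by filter_upwards [hu] with x hx; rw [hx])

theorem isWeakDeriv_zero (f : L2 d) : IsWeakDeriv 0 (f : 𝕍 d → ℝ) f :=
  ⟨L2_locallyIntegrable f, fun φ _ _ => by simp [multiD_zero]⟩

theorem IsWeakDeriv.sub {α : Fin d → ℕ} {u u' : 𝕍 d → ℝ} {f f' : L2 d}
    (h : IsWeakDeriv α u f) (h' : IsWeakDeriv α u' f') :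
    IsWeakDeriv α (fun x => u x - u' x) (f - f') := by
  refine ⟨h.1.sub h'.1, fun φ hφ hc => ?_⟩
  have hi : ∀ {w : 𝕍 d → ℝ}, LocallyIntegrable w volume →
      Integrable fun x => w x * multiD α φ x := fun hw => by
    have := hw.integrable_smul_left_of_hasCompactSupport (multiD_smooth α hφ).continuous
      (multiD_hasCompactSupport α hc)
    simpa [smul_eq_mul, mul_comm] using this
  have hφ2 := testFunction_memLp hφ.continuous hc
  simp_rw [sub_mul]
  rw [integral_sub (hi h.1) (hi h'.1), h.2 φ hφ hc, h'.2 φ hφ hc, integral_mul_test _ hφ2,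
    integral_mul_test _ hφ2, integral_mul_test _ hφ2, inner_sub_left]
  ring

theorem MemH.isWeakDeriv {n : ℕ} {u : 𝕍 d → ℝ} (hu : MemH n u) {α : Fin d → ℕ}
    (hα : ∑ i, α i ≤ n) : IsWeakDeriv α u (weakDeriv α u) := by
  obtain ⟨v, hv⟩ := hu.2 α hα
  rwa [hv.weakDeriv_eq]

theorem MemH.hasPartial {n : ℕ} {u : 𝕍 d → ℝ} (hu : MemH n u) {α : Fin d → ℕ}
    (hα : ∑ i, α i + 1 ≤ n) (i : Fin d) :
    HasPartial i (weakDeriv α u) (weakDeriv (α + Pi.single i 1) u) :=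
  (hu.isWeakDeriv (by omega)).hasPartial (hu.isWeakDeriv (by rwa [sum_add_single]))

theorem MemH.weakDeriv_zero {n : ℕ} {u : 𝕍 d → ℝ} (hu : MemH n u) :
    weakDeriv 0 u =ᵐ[volume] u := by
  have h : IsWeakDeriv 0 u (hu.1.toLp u) := (isWeakDeriv_zero _).congr hu.1.coeFn_toLp
  rw [h.weakDeriv_eq]
  exact hu.1.coeFn_toLp

theorem norm_weakDeriv_le_normH {k : ℕ} (u : 𝕍 d → ℝ) {α : Fin d → ℕ} (hα : ∑ i, α i ≤ k) :
    ‖weakDeriv α u‖ ≤ normH k u := by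
  refine Real.le_sqrt_of_sq_le ?_
  refine Finset.single_le_sum (f := fun α => ‖weakDeriv α u‖ ^ 2) (fun _ _ => sq_nonneg _) ?_
  rw [Finset.mem_filter, Fintype.mem_piFinset]
  refine ⟨fun i => ?_, hα⟩
  rw [Finset.mem_range]
  have := Finset.single_le_sum (f := α) (fun _ _ => Nat.zero_le _) (Finset.mem_univ i)
  omega

end WeakDerivatives

/-! ### Expansion of the derivatives of `u(x + c(x))` -/

section Expansion

variable {d : ℕ}

/-- `X` is a finite sum of terms `b (∂^β u)(· + c)` and `Y` is the corresponding sum of the terms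
`b ∂^β u`, where `|β| ≤ n`, the coefficients `b` have derivatives of order at most `k`
bounded by some constants, and the sum of these constants is at most `M`. The family `U` stands for
the family of the derivatives `∂^β u`. -/
inductive CoefSum (c : 𝕍 d → 𝕍 d) (U : (Fin d → ℕ) → L2 d) (n k : ℕ) :
    ℝ → L2 d → L2 d → Prop
  | zero : CoefSum c U n k 0 0 0
  | mono {M M' : ℝ} {X Y : L2 d} : CoefSum c U n k M X Y → M ≤ M' → CoefSum c U n k M' X Y
  | add {M M' : ℝ} {X X' Y Y' : L2 d} : CoefSum c U n k M X Y → CoefSum c U n k M' X' Y' →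
      CoefSum c U n k (M + M') (X + X') (Y + Y')
  | term {M : ℝ} {b : 𝕍 d → ℝ} {β : Fin d → ℕ} : DerivBound k M b → ∑ i, β i ≤ n →
      CoefSum c U n k M (mulOp b (compOp c (U β))) (mulOp b (U β))

namespace CoefSum

variable {c : 𝕍 d → 𝕍 d} {U : (Fin d → ℕ) → L2 d} {n k : ℕ} {M : ℝ} {X Y : L2 d}

theorem of_le {n' k' : ℕ} (h : CoefSum c U n k M X Y) (hn : n ≤ n') (hk : k' ≤ k) :
    CoefSum c U n' k' M X Y := by
  induction h with
  | zero => exact .zero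
  | mono _ hM ih => exact ih.mono hM
  | add _ _ ih ih' => exact ih.add ih'
  | term hb hβ => exact .term (hb.of_le hk) (hβ.trans hn)

theorem sum {ι : Type*} (s : Finset ι) {X Y : ι → L2 d} (h : ∀ a, CoefSum c U n k M (X a) (Y a)) :
    CoefSum c U n k (s.card * M) (∑ a ∈ s, X a) (∑ a ∈ s, Y a) := by
  classical
  induction s using Finset.induction_on with
  | empty => simpa using CoefSum.zero
  | insert a s ha ih =>
    rw [Finset.sum_insert ha, Finset.sum_insert ha, Finset.card_insert_of_notMem ha]
    push_cast
    rw [show ((s.card : ℝ) + 1) * M = M + s.card * M by ring]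
    exact (h a).add ih

variable {m : ℕ} {K κ : ℝ}

theorem norm_le (h : CoefSum c U n k M X Y) (hc : JumpField m K κ c) (hK : 0 < K) {S : ℝ}
    (hS : ∀ β, ∑ i, β i ≤ n → ‖U β‖ ≤ S) (hS0 : 0 ≤ S) : ‖X‖ ≤ M * (K * S) := by
  induction h with
  | zero => simp
  | mono _ hM ih => exact ih.trans (mul_le_mul_of_nonneg_right hM (by positivity))
  | add _ _ ih ih' => rw [add_mul]; exact (norm_add_le _ _).trans (add_le_add ih ih')
  | term hb hβ =>
    refine (hb.norm_mulOp_le _).trans (mul_le_mul_of_nonneg_left ?_ hb.nonneg)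
    exact (hc.norm_compOp_le hK _).trans (mul_le_mul_of_nonneg_left (hS _ hβ) hK.le)

theorem norm_sub_le (h : CoefSum c U n k M X Y) (hc : JumpField m K κ c) (hK : 0 < K) {S : ℝ}
    (hU : ∀ β, ∑ i, β i ≤ n → ∀ i, HasPartial i (U β) (U (β + Pi.single i 1)))
    (hS : ∀ β, ∑ i, β i ≤ n + 1 → ‖U β‖ ≤ S) (hS0 : 0 ≤ S) :
    ‖X - Y‖ ≤ M * (κ * (d * (K * S))) := by
  have hκ := hc.nonneg
  induction h with
  | zero => simp
  | mono _ hM ih => exact ih.trans (mul_le_mul_of_nonneg_right hM (by positivity))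
  | add _ _ ih ih' =>
    rw [add_mul, add_sub_add_comm]; exact (norm_add_le _ _).trans (add_le_add ih ih')
  | term hb hβ =>
    rw [← map_sub]
    refine (hb.norm_mulOp_le _).trans (mul_le_mul_of_nonneg_left ?_ hb.nonneg)
    exact hc.norm_compOp_sub_le hK (hU _ hβ)
      (fun j => hS _ (by rw [sum_add_single]; omega)) hS0

/-- The hypothesis `hC` is the conclusion of `exists_inner_mulOp_compOp_bound`. -/
theorem abs_inner_sub_le (h : CoefSum c U n k M X Y) (hk : 1 ≤ k) (hc : JumpField m K κ c) {C : ℝ}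
    (hC0 : 0 ≤ C)
    (hC : ∀ (M : ℝ) (b : 𝕍 d → ℝ), DerivBound 1 M b → ∀ f g : L2 d,
      |inner ℝ (compOp c f) (mulOp b (compOp c g)) - inner ℝ f (mulOp b g)|
        ≤ C * (M * κ) * (‖f‖ * ‖g‖)) {S : ℝ} (hS : ∀ β, ∑ i, β i ≤ n → ‖U β‖ ≤ S) (v : L2 d) :
    |inner ℝ (compOp c v) X - inner ℝ v Y| ≤ M * (C * κ * (‖v‖ * S)) := by
  have hκ := hc.nonneg
  have hS0 : 0 ≤ S := (norm_nonneg _).trans (hS 0 (by simp))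
  induction h with
  | zero => simp
  | mono _ hM ih => exact ih.trans (mul_le_mul_of_nonneg_right hM (by positivity))
  | add _ _ ih ih' =>
    rw [inner_add_right, inner_add_right, add_sub_add_comm, add_mul]
    exact (abs_add_le _ _).trans (add_le_add ih ih')
  | term hb hβ =>
    refine (hC _ _ (hb.of_le hk) _ _).trans ?_
    have := hb.nonneg
    have h1 := hS _ hβ
    calc _ ≤ C * (_ * κ) * (‖v‖ * S) := by gcongr
      _ = _ := by ring

/-- Differentiating a sum of coefficients times derivatives of `u(· + c)` yields a sum of the same
kind and a sum in which each coefficient has an additional factor of size `κ`. -/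
theorem hasPartial (h : CoefSum c U n (k + 1) M X Y) (hc : JumpField m K κ c) (hK : 0 < K)
    (hk : k ≤ m) (hU : ∀ β, ∑ i, β i ≤ n → ∀ i, HasPartial i (U β) (U (β + Pi.single i 1)))
    (i : Fin d) : ∃ X' Y' R Y'', CoefSum c U (n + 1) k (2 * M) X' Y' ∧
      CoefSum c U (n + 1) k (d * 2 ^ k * (M * κ)) R Y'' ∧
      HasPartial i X (X' + R) ∧ HasPartial i Y Y' := by
  have hκ := hc.nonneg
  induction h with
  | zero =>
    refine ⟨0, 0, 0, 0, by simpa using CoefSum.zero, by simpa using CoefSum.zero, ?_, .zero⟩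
    simpa using HasPartial.zero
  | mono _ hM ih =>
    obtain ⟨X', Y', R, Y'', h1, h2, h3, h4⟩ := ih
    exact ⟨X', Y', R, Y'', h1.mono (by linarith), h2.mono (by gcongr), h3, h4⟩
  | add _ _ ih ih' =>
    obtain ⟨X₁, Y₁, R₁, Z₁, h1, h2, h3, h4⟩ := ih
    obtain ⟨X₂, Y₂, R₂, Z₂, h1', h2', h3', h4'⟩ := ih'
    refine ⟨X₁ + X₂, Y₁ + Y₂, R₁ + R₂, Z₁ + Z₂, (h1.add h1').mono (by linarith),
      (h2.add h2').mono (le_of_eq (by ring)), ?_, h4.add h4'⟩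
    rw [add_add_add_comm]
    exact h3.add h3'
  | @term M b β hb hβ =>
    have h1 : DerivBound 1 M b := hb.of_le (by omega)
    have hgrad := hU β hβ
    refine ⟨mulOp (partialD i b) (compOp c (U β)) + mulOp b (compOp c (U (β + Pi.single i 1))),
      mulOp (partialD i b) (U β) + mulOp b (U (β + Pi.single i 1)),
      ∑ j, mulOp (fun x => b x * partialD i (fun y => c y j) x)
        (compOp c (U (β + Pi.single j 1))),
      ∑ j, mulOp (fun x => b x * partialD i (fun y => c y j) x) (U (β + Pi.single j 1)),
      ?_, ?_, ?_, HasPartial.mulOp hgrad h1 i⟩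
    · exact ((term (hb.2.2 i) (by omega)).add
        (term hb.of_succ (by rw [sum_add_single]; omega))).mono (by linarith)
    · have := sum (c := c) (U := U) (n := n + 1) (k := k) (M := 2 ^ k * (M * κ)) Finset.univ
        (X := fun j => mulOp (fun x => b x * partialD i (fun y => c y j) x)
          (compOp c (U (β + Pi.single j 1))))
        (Y := fun j => mulOp (fun x => b x * partialD i (fun y => c y j) x)
          (U (β + Pi.single j 1)))
        fun j => term (hb.of_succ.mul (((hc.derivBound j).2.2 i).of_le hk))
          (by rw [sum_add_single]; omega)
      rw [Finset.card_univ, Fintype.card_fin] at this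
      exact this.mono (le_of_eq (by ring))
    · have h2 := HasPartial.mulOp (fun i => HasPartial.compOp hgrad hc hK i) h1 i
      rw [map_add, map_sum] at h2
      simp_rw [h1.mulOp_mulOp ((hc.derivBound _).2.2 i)] at h2
      rw [add_assoc]
      exact h2

end CoefSum

variable {m : ℕ} {K κ : ℝ} {c : 𝕍 d → 𝕍 d}

/-- The transport term `c · ∇u` of the family `U` of derivatives of `u`, differentiated `α`
times with all derivatives falling on `∇u`. -/
noncomputable def transport (c : 𝕍 d → 𝕍 d) (U : (Fin d → ℕ) → L2 d) (α : Fin d → ℕ) : L2 d :=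
  ∑ j, mulOp (fun x => c x j) (U (α + Pi.single j 1))

/-- Up to a remainder of size `κ^2`, the derivative `∂^α (u(· + c))` is `(∂^α u)(· + c)` plus
the composition with `x + c(x)` of the commutator `∂^α (c · ∇u) - c · ∇∂^α u`. -/
theorem exists_expansion (d m : ℕ) {K : ℝ} (hK : 0 < K) (n : ℕ) (hn : n ≤ m) :
    ∃ C, 0 ≤ C ∧ ∀ (κ : ℝ) (c : 𝕍 d → 𝕍 d), JumpField m K κ c →
    ∀ u : 𝕍 d → ℝ, MemH (m + 2) u → ∀ α : Fin d → ℕ, ∑ i, α i = n →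
    ∃ X Y R Y' : L2 d,
      CoefSum c (fun β => weakDeriv β u) n (m + 1 - n) (C * κ) X Y ∧
      CoefSum c (fun β => weakDeriv β u) n (m + 1 - n) (C * κ ^ 2) R Y' ∧
      IsWeakDeriv α (fun x => u (x + c x)) (compOp c (weakDeriv α u) + X + R) ∧
      IsWeakDeriv α (fun x => ∑ i, c x i * weakDeriv (Pi.single i 1) u x)
        (transport c (fun β => weakDeriv β u) α + Y) := by
  induction n with
  | zero =>
    refine ⟨0, le_rfl, fun κ c hc u hu α hα => ⟨0, 0, 0, 0, ?_, ?_, ?_, ?_⟩⟩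
    · simpa using CoefSum.zero
    · simpa using CoefSum.zero
    all_goals
      have hα0 : α = 0 := by
        funext i
        have := Finset.single_le_sum (f := α) (fun _ _ => Nat.zero_le _) (Finset.mem_univ i)
        rw [hα] at this
        exact Nat.le_zero.1 this
      subst hα0
    · rw [add_zero, add_zero]
      refine (isWeakDeriv_zero _).congr ((hc.coe_compOp hK _).trans ?_)
      exact (hc.quasiMeasurePreserving hK).ae_eq_comp hu.weakDeriv_zero
    · rw [add_zero]
      refine (isWeakDeriv_zero _).congr ?_
      unfold transport
      simp_rw [zero_add]
      exact coe_sum_mulOp hc _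
  | succ n ih =>
    obtain ⟨C, hC0, ih⟩ := ih (by omega)
    obtain ⟨k, rfl⟩ : ∃ k, m = n + k := ⟨m - n, by omega⟩
    have hk1 : n + k + 1 - n = k + 1 := by omega
    have hk2 : n + k + 1 - (n + 1) = k := by omega
    rw [hk1] at ih
    rw [hk2]
    refine ⟨d + 2 * C + d * 2 ^ k * C + d * 2 ^ k * C * K, by positivity,
      fun κ c hc u hu α hα => ?_⟩
    have hκ := hc.nonneg
    obtain ⟨β, i, rfl, hβ⟩ := exists_eq_add_single hα
    obtain ⟨X, Y, R, Y', h1, h2, h3, h4⟩ := ih κ c hc u hu β hβ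
    have hU : ∀ γ : Fin d → ℕ, ∑ i, γ i ≤ n → ∀ i,
        HasPartial i (weakDeriv γ u) (weakDeriv (γ + Pi.single i 1) u) :=
      fun γ hγ i => hu.hasPartial (by omega) i
    obtain ⟨X₁, Y₁, R₁, Z₁, a1, a2, a3, a4⟩ := h1.hasPartial hc hK (by omega) hU i
    obtain ⟨X₂, Y₂, R₂, Z₂, b1, b2, b3, -⟩ := h2.hasPartial hc hK (by omega) hU i
    have hT := HasPartial.compOp (hU β hβ.le) hc hK i
    have hD : CoefSum c (fun β => weakDeriv β u) (n + 1) k (d * κ)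
        (∑ j, mulOp (partialD i fun x => c x j) (compOp c (weakDeriv (β + Pi.single j 1) u)))
        (∑ j, mulOp (partialD i fun x => c x j) (weakDeriv (β + Pi.single j 1) u)) := by
      have := CoefSum.sum (c := c) (U := fun β => weakDeriv β u) (n := n + 1) (k := k) (M := κ)
        Finset.univ
        (X := fun j => mulOp (partialD i fun x => c x j)
          (compOp c (weakDeriv (β + Pi.single j 1) u)))
        (Y := fun j => mulOp (partialD i fun x => c x j) (weakDeriv (β + Pi.single j 1) u))
        fun j => CoefSum.term (((hc.derivBound j).2.2 i).of_le (by omega))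
          (by rw [sum_add_single]; omega)
      rwa [Finset.card_univ, Fintype.card_fin] at this
    have hL : HasPartial i (transport c (fun β => weakDeriv β u) β)
        (transport c (fun β => weakDeriv β u) (β + Pi.single i 1)
          + ∑ j, mulOp (partialD i fun x => c x j) (weakDeriv (β + Pi.single j 1) u)) := by
      unfold transport
      rw [← Finset.sum_add_distrib]
      refine HasPartial.sum _ fun j => ?_
      have := HasPartial.mulOp (f := weakDeriv (β + Pi.single j 1) u)
        (g := fun i => weakDeriv (β + Pi.single j 1 + Pi.single i 1) u)
        (fun i => hu.hasPartial (by rw [sum_add_single]; omega) i)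
        ((hc.derivBound j).of_le (by omega)) i
      rw [add_right_comm]
      convert! this using 1
      exact add_comm _ _
    -- The derivatives of `c` in the chain rule for `T ∂^β u` are first-order coefficients; those in
    -- the chain rule for `X` and `R` multiply coefficients that are already of size `κ` or `κ^2`.
    refine ⟨_, _, _, _, (hD.add a1).mono ?_, ((a2.add b1).add b2).mono ?_, ?_, ?_⟩
    · have : 0 ≤ d * 2 ^ k * C + d * 2 ^ k * C * K := by positivity
      nlinarith
    · have e1 : d * 2 ^ k * (C * κ ^ 2 * κ) ≤ d * 2 ^ k * (C * κ ^ 2 * K) := by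
        have := hc.le
        gcongr
      have e2 : 0 ≤ (d : ℝ) * κ ^ 2 := by positivity
      nlinarith
    · have := h3.partial ((hT.add a3).add b3)
      convert! this using 1
      abel
    · have := h4.partial (hL.add a4)
      rwa [add_assoc] at this

/-- A version of `exists_expansion` with a constant independent of the multi-index. -/
theorem exists_uniform_expansion (d m : ℕ) {K : ℝ} (hK : 0 < K) :
    ∃ C, 0 ≤ C ∧ ∀ (κ : ℝ) (c : 𝕍 d → 𝕍 d), JumpField m K κ c →
    ∀ u : 𝕍 d → ℝ, MemH (m + 2) u → ∀ α : Fin d → ℕ, ∑ i, α i ≤ m →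
    ∃ X Y R Y' : L2 d,
      CoefSum c (fun β => weakDeriv β u) m 1 (C * κ) X Y ∧
      CoefSum c (fun β => weakDeriv β u) m 1 (C * κ ^ 2) R Y' ∧
      IsWeakDeriv α (fun x => u (x + c x)) (compOp c (weakDeriv α u) + X + R) ∧
      IsWeakDeriv α (fun x => ∑ i, c x i * weakDeriv (Pi.single i 1) u x)
        (transport c (fun β => weakDeriv β u) α + Y) := by
  choose! C hC0 hC using fun n (hn : n ≤ m) => exists_expansion d m hK n hn
  have hC0' : ∀ n ∈ Finset.range (m + 1), 0 ≤ C n := fun n hn =>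
    hC0 n (Nat.lt_succ_iff.1 (Finset.mem_range.1 hn))
  refine ⟨∑ n ∈ Finset.range (m + 1), C n, Finset.sum_nonneg hC0', fun κ c hc u hu α hα => ?_⟩
  have hκ := hc.nonneg
  obtain ⟨X, Y, R, Y', h1, h2, h3, h4⟩ := hC _ hα κ c hc u hu α rfl
  have hle := Finset.single_le_sum hC0' (Finset.mem_range.2 (Nat.lt_succ_iff.2 hα))
  exact ⟨X, Y, R, Y', (h1.of_le hα (by omega)).mono (mul_le_mul_of_nonneg_right hle hκ),
    (h2.of_le hα (by omega)).mono (mul_le_mul_of_nonneg_right hle (sq_nonneg _)), h3, h4⟩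

end Expansion

/-! ### The estimate for a fixed displacement field -/

section Pointwise

variable {d m : ℕ} {K κ : ℝ} {c : 𝕍 d → 𝕍 d}

theorem inner_mulOp_comm {b : 𝕍 d → ℝ} {M : ℝ} (hb : Continuous b) (hM : ∀ x, |b x| ≤ M)
    (f g : L2 d) : inner ℝ f (mulOp b g) = inner ℝ g (mulOp b f) := by
  rw [inner_mulOp_eq hb hM, inner_mulOp_eq hb hM]
  simp_rw [mul_comm (g _)]

/-- `2 (c · ∇v, v)_0 = -((div c) v, v)_0`. -/
theorem JumpField.two_mul_inner_transport (hc : JumpField m K κ c) {v : L2 d} {g : Fin d → L2 d}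
    (hv : ∀ i, HasPartial i v (g i)) :
    2 * inner ℝ v (∑ j, mulOp (fun x => c x j) (g j)) = - inner ℝ v (mulOp (divergence c) v) := by
  have hdiv : mulOp (divergence c) v = ∑ j, mulOp (partialD j fun x => c x j) v := by
    refine Lp.ext ?_
    have h1 : ∀ᵐ x, ∀ j, mulOp (partialD j fun x => c x j) v x
        = partialD j (fun x => c x j) x * v x := by
      rw [ae_all_iff]
      exact fun j => ((hc.derivBound j).2.2 j).coe_mulOp v
    filter_upwards [h1, hc.derivBound_divergence.coe_mulOp v,
      Lp.coeFn_finsetSum Finset.univ fun j => mulOp (partialD j fun x => c x j) v]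
      with x h1 h2 h3
    rw [h2, h3]
    simp [h1, divergence, Finset.sum_mul]
  rw [hdiv, inner_sum, inner_sum, Finset.mul_sum, ← Finset.sum_neg_distrib]
  refine Finset.sum_congr rfl fun j _ => ?_
  have hb : DerivBound 1 κ fun x => c x j := (hc.derivBound j).of_le (by omega)
  have h := inner_partial_eq_neg hv (fun i => HasPartial.mulOp hv hb i) j
  rw [inner_add_right, inner_mulOp_comm hb.continuous hb.abs_le] at h
  linarith

/-- The expansion of `‖w - v‖^2 + 2 (w - v - l, v)` for `w = a + x + r` and `l = t + y`. -/
theorem norm_sub_sq_add_two_mul_inner {H : Type*} [NormedAddCommGroup H] [InnerProductSpace ℝ H]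
    (a x r v t y : H) :
    ‖a + x + r - v‖ ^ 2 + 2 * inner ℝ (a + x + r - v - (t + y)) v
      = (‖a‖ ^ 2 - ‖v‖ ^ 2 - 2 * inner ℝ v t) + 2 * (inner ℝ a x - inner ℝ v y)
        + 2 * inner ℝ a r + ‖x + r‖ ^ 2 := by
  rw [norm_sub_sq_real, add_assoc a, norm_add_sq_real a, inner_sub_left, inner_sub_left,
    inner_add_left t, inner_add_right, real_inner_comm v t, real_inner_comm v y,
    real_inner_self_eq_norm_sq]
  ring

/-- The estimates for a fixed displacement field: `W` is `∂^α (u(· + c))` and `L` is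
`∂^α (c · ∇u)`. Existence of the integrals over `Z` follows from the first two
bounds, which involve `m + 2` derivatives of `u`; in the third one the terms of first order in `κ`
cancel and only `m` derivatives are needed. -/
theorem exists_pointwise_bound (d m : ℕ) (hm : 1 ≤ m) {K : ℝ} (hK : 0 < K) :
    ∃ N, 0 ≤ N ∧ ∀ (κ : ℝ) (c : 𝕍 d → 𝕍 d), JumpField m K κ c →
    ∀ u : 𝕍 d → ℝ, MemH (m + 2) u → ∀ α : Fin d → ℕ, ∑ i, α i ≤ m → ∃ W L : L2 d,
      IsWeakDeriv α (fun x => u (x + c x)) W ∧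
      IsWeakDeriv α (fun x => ∑ i, c x i * weakDeriv (Pi.single i 1) u x) L ∧
      ‖W - weakDeriv α u‖ ≤ N * normH (m + 2) u * κ ∧
      ‖W - weakDeriv α u - L‖ ≤ N * normH (m + 2) u * κ ^ 2 ∧
      ‖W - weakDeriv α u‖ ^ 2 + 2 * inner ℝ (W - weakDeriv α u - L) (weakDeriv α u)
        ≤ N * normH m u ^ 2 * κ ^ 2 := by
  obtain ⟨C, hC0, hC⟩ := exists_uniform_expansion d m hK
  obtain ⟨C₁, hC₁0, hC₁⟩ := exists_inner_mulOp_compOp_bound d hK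
  obtain ⟨C₂, hC₂0, hC₂⟩ := exists_norm_compOp_sq_bound d hK
  set N₁ : ℝ := d * K + C * K + C * K * K
  set N₂ : ℝ := d * (d * K) + C * (d * K) + C * K
  set N₃ : ℝ := C₂ + 2 * (C * C₁) + 2 * (K * (C * K)) + (C * K + C * K * K) ^ 2
  have hN₁ : 0 ≤ N₁ := by positivity
  have hN₂ : 0 ≤ N₂ := by positivity
  have hN₃ : 0 ≤ N₃ := by positivity
  refine ⟨N₁ + N₂ + N₃, by positivity, fun κ c hc u hu α hα => ?_⟩
  obtain ⟨X, Y, R, Y', h1, h2, h3, h4⟩ := hC κ c hc u hu α hα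
  have hκ := hc.nonneg
  have hκK := hc.le
  set v := weakDeriv α u
  set S := normH m u
  set S₂ := normH (m + 2) u
  have hS0 : 0 ≤ S := Real.sqrt_nonneg _
  have hS₂0 : 0 ≤ S₂ := Real.sqrt_nonneg _
  have hS : ∀ β : Fin d → ℕ, ∑ i, β i ≤ m → ‖weakDeriv β u‖ ≤ S :=
    fun β hβ => norm_weakDeriv_le_normH u hβ
  have hS₂ : ∀ β : Fin d → ℕ, ∑ i, β i ≤ m + 2 → ‖weakDeriv β u‖ ≤ S₂ :=
    fun β hβ => norm_weakDeriv_le_normH u hβ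
  have hgv : ∀ i, HasPartial i v (weakDeriv (α + Pi.single i 1) u) :=
    fun i => hu.hasPartial (by omega) i
  have hU : ∀ β : Fin d → ℕ, ∑ i, β i ≤ m → ∀ i,
      HasPartial i (weakDeriv β u) (weakDeriv (β + Pi.single i 1) u) :=
    fun β hβ i => hu.hasPartial (by omega) i
  refine ⟨_, _, h3, h4, ?_, ?_, ?_⟩
  · have e : compOp c v + X + R - v = (compOp c v - v) + X + R := by abel
    rw [e]
    have b1 := hc.norm_compOp_sub_le hK hgv (G := S₂)
      (fun j => hS₂ _ (by rw [sum_add_single]; omega)) hS₂0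
    have b2 := h1.norm_le hc hK (fun β hβ => hS₂ β (by omega)) hS₂0
    have b3 := h2.norm_le hc hK (fun β hβ => hS₂ β (by omega)) hS₂0
    have b4 : C * κ ^ 2 * (K * S₂) ≤ C * (κ * K) * (K * S₂) := by
      rw [pow_two]; gcongr
    calc _ ≤ ‖compOp c v - v‖ + ‖X‖ + ‖R‖ := norm_add₃_le
      _ ≤ κ * (d * (K * S₂)) + C * κ * (K * S₂) + C * (κ * K) * (K * S₂) := by
        linarith
      _ = N₁ * S₂ * κ := by ring
      _ ≤ _ := by gcongr; linarith
  · have e : compOp c v + X + R - v - (transport c (fun β => weakDeriv β u) α + Y)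
        = (compOp c v - v - transport c (fun β => weakDeriv β u) α) + (X - Y) + R := by abel
    rw [e]
    have b1 := hc.norm_compOp_sub_sub_le hK hgv (G := S₂)
      (g₂ := fun j i => weakDeriv (α + Pi.single j 1 + Pi.single i 1) u)
      (fun j i => hu.hasPartial (by rw [sum_add_single]; omega) i)
      (fun j i => hS₂ _ (by rw [sum_add_single, sum_add_single]; omega)) hS₂0
    have b2 := h1.norm_sub_le hc hK hU (fun β hβ => hS₂ β (by omega)) hS₂0
    have b3 := h2.norm_le hc hK (fun β hβ => hS₂ β (by omega)) hS₂0
    calc _ ≤ ‖compOp c v - v - transport c (fun β => weakDeriv β u) α‖ + ‖X - Y‖ + ‖R‖ :=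
          norm_add₃_le
      _ ≤ κ * (d * (κ * (d * (K * S₂)))) + C * κ * (κ * (d * (K * S₂)))
          + C * κ ^ 2 * (K * S₂) := add_le_add (add_le_add b1 b2) b3
      _ = N₂ * S₂ * κ ^ 2 := by ring
      _ ≤ _ := by gcongr; linarith
  · set T := transport c (fun β => weakDeriv β u) α with hT
    have hv : ‖v‖ ≤ S := hS α hα
    have t1 : ‖compOp c v‖ ^ 2 - ‖v‖ ^ 2 + inner ℝ v (mulOp (divergence c) v)
        ≤ C₂ * κ ^ 2 * S ^ 2 := by
      refine (le_abs_self _).trans ((hC₂ m κ c hm hc v).trans ?_)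
      gcongr
    have t2 : 2 * inner ℝ v T = - inner ℝ v (mulOp (divergence c) v) :=
      hc.two_mul_inner_transport hgv
    have t3 : inner ℝ (compOp c v) X - inner ℝ v Y ≤ C * κ * (C₁ * κ * (S * S)) := by
      refine (le_abs_self _).trans ((h1.abs_inner_sub_le le_rfl hc hC₁0 (hC₁ m κ c hc) hS v).trans
        ?_)
      gcongr
    have r1 : ‖X‖ ≤ C * κ * (K * S) := h1.norm_le hc hK hS hS0
    have r2 : ‖R‖ ≤ C * κ ^ 2 * (K * S) := h2.norm_le hc hK hS hS0
    have t4 : inner ℝ (compOp c v) R ≤ K * S * (C * κ ^ 2 * (K * S)) := by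
      refine (real_inner_le_norm _ _).trans ?_
      have : ‖compOp c v‖ ≤ K * S := (hc.norm_compOp_le hK v).trans (by gcongr)
      gcongr
    have t5 : ‖X + R‖ ^ 2 ≤ (C * κ * (K * S) + C * (κ * K) * (K * S)) ^ 2 := by
      have b4 : C * κ ^ 2 * (K * S) ≤ C * (κ * K) * (K * S) := by
        rw [pow_two]; gcongr
      have := (norm_add_le X R).trans (add_le_add r1 (r2.trans b4))
      gcongr
    rw [norm_sub_sq_add_two_mul_inner]
    calc _ ≤ C₂ * κ ^ 2 * S ^ 2 + 2 * (C * κ * (C₁ * κ * (S * S)))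
          + 2 * (K * S * (C * κ ^ 2 * (K * S)))
          + (C * κ * (K * S) + C * (κ * K) * (K * S)) ^ 2 := by linarith
      _ = N₃ * S ^ 2 * κ ^ 2 := by ring
      _ ≤ _ := by gcongr; linarith

end Pointwise

/-! ### Measurability of families of weak derivatives -/

section Measurability

/-- A weakly measurable map into a separable real inner product space is strongly measurable. -/
theorem stronglyMeasurable_of_inner {Z H : Type*} [MeasurableSpace Z] [NormedAddCommGroup H]
    [InnerProductSpace ℝ H] [SecondCountableTopology H] {F : Z → H}
    (h : ∀ y, Measurable fun z => inner ℝ (F z) y) : StronglyMeasurable F := by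
  borelize H
  suffices hm : Measurable F from hm.stronglyMeasurable
  let q : ℕ → H := TopologicalSpace.denseSeq H
  have hq : DenseRange q := TopologicalSpace.denseRange_denseSeq H
  -- A ball is a countable intersection of half-spaces, one for each point of a dense sequence.
  have hball : ∀ (p : H) (r : ℝ), MeasurableSet {z | ‖F z - p‖ ≤ r} := by
    intro p r
    by_cases hr : 0 ≤ r
    swap
    · have : {z | ‖F z - p‖ ≤ r} = ∅ := by
        ext z; simpa using (not_le.1 hr).trans_le (norm_nonneg (F z - p))
      rw [this]; exact MeasurableSet.empty
    have e : {z | ‖F z - p‖ ≤ r} = ⋂ n, {z | inner ℝ (F z) (q n) - inner ℝ p (q n)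
        ≤ r * ‖q n‖} := by
      ext z
      simp only [Set.mem_ofPred_eq, Set.mem_iInter, ← inner_sub_left]
      refine ⟨fun hz n => (real_inner_le_norm _ _).trans (by gcongr), fun hz => ?_⟩
      have hall : ∀ y, inner ℝ (F z - p) y ≤ r * ‖y‖ := fun y =>
        hq.induction_on (p := fun y => inner ℝ (F z - p) y ≤ r * ‖y‖) y
          (isClosed_le (by fun_prop) (by fun_prop)) hz
      have := hall (F z - p)
      rw [real_inner_self_eq_norm_sq, pow_two] at this
      by_contra! hlt
      exact absurd this (not_le.2 (mul_lt_mul_of_pos_right hlt (hr.trans_lt hlt)))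
    rw [e]
    exact MeasurableSet.iInter fun n => measurableSet_le ((h _).sub_const _) measurable_const
  refine measurable_of_isOpen fun O hO => ?_
  have e : F ⁻¹' O = ⋃ (n : ℕ) (r : ℚ) (_ : Metric.closedBall (q n) r ⊆ O),
      {z | ‖F z - q n‖ ≤ r} := by
    ext z
    simp only [Set.mem_preimage, Set.mem_iUnion, Set.mem_ofPred_eq, exists_prop]
    constructor
    · intro hz
      obtain ⟨ε, hε, hO'⟩ := Metric.isOpen_iff.1 hO _ hz
      obtain ⟨r, hr0, hr⟩ := exists_rat_btwn (half_pos hε)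
      obtain ⟨n, hn⟩ := hq.exists_dist_lt (F z) hr0
      refine ⟨n, r, fun y hy => hO' ?_, ?_⟩
      · rw [Metric.mem_closedBall] at hy
        rw [Metric.mem_ball]
        have := dist_triangle y (q n) (F z)
        rw [dist_comm (q n)] at this
        linarith
      · rw [← dist_eq_norm_sub]; exact hn.le
    · rintro ⟨n, r, hsub, hz⟩
      exact hsub (by rwa [Metric.mem_closedBall, dist_eq_norm_sub])
  rw [e]
  exact MeasurableSet.iUnion fun n => MeasurableSet.iUnion fun r => MeasurableSet.iUnion fun _ =>
    hball _ _

variable {d : ℕ}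

/-- Test functions are total in `L_2`. -/
theorem span_testFunctions_dense : (Submodule.span ℝ {g : L2 d | ∃ (φ : 𝕍 d → ℝ)
    (_ : ContDiff ℝ ∞ φ) (_ : HasCompactSupport φ) (h : MemLp φ 2 volume),
      g = h.toLp φ}).topologicalClosure = ⊤ := by
  rw [Submodule.topologicalClosure_eq_top_iff, Submodule.eq_bot_iff]
  intro f hf
  rw [Submodule.mem_orthogonal] at hf
  have h0 : f =ᵐ[volume] fun _ => (0 : ℝ) := by
    refine ae_eq_of_integral_contDiff_smul_eq (L2_locallyIntegrable f)
      (locallyIntegrable_const 0) fun φ hφ hc => ?_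
    have h1 := hf ((testFunction_memLp hφ.continuous hc).toLp φ)
      (Submodule.subset_span ⟨φ, hφ, hc, testFunction_memLp hφ.continuous hc, rfl⟩)
    rw [real_inner_comm, ← integral_mul_test] at h1
    simpa [mul_comm] using h1
  exact Lp.ext (h0.trans (Lp.coeFn_zero ℝ 2 volume).symm)

/-- The weak derivatives in `L_2` of a jointly measurable family of functions form a strongly
measurable family. -/
theorem stronglyMeasurable_of_isWeakDeriv {Z : Type*} [MeasurableSpace Z] {α : Fin d → ℕ}
    {w : 𝕍 d → Z → ℝ} (hw : Measurable (Function.uncurry w)) {F : Z → L2 d}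
    (hF : ∀ z, IsWeakDeriv α (fun x => w x z) (F z)) : StronglyMeasurable F := by
  have : Fact ((2 : ℝ≥0∞) ≠ ⊤) := ⟨by norm_num⟩
  refine stronglyMeasurable_of_inner fun y => ?_
  let s : Submodule ℝ (L2 d) :=
    { carrier := {y | Measurable fun z => inner ℝ (F z) y}
      add_mem' := fun {a b} ha hb => by
        simp only [Set.mem_ofPred_eq, inner_add_right] at ha hb ⊢
        exact ha.add hb
      zero_mem' := by simp
      smul_mem' := fun r a ha => by
        simp only [Set.mem_ofPred_eq, inner_smul_right] at ha ⊢
        exact ha.const_mul r }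
  have hs : IsClosed (s : Set (L2 d)) := by
    refine isClosed_of_closure_subset fun a ha => ?_
    obtain ⟨x, hx, hlim⟩ := mem_closure_iff_seq_limit.1 ha
    change Measurable fun z => inner ℝ (F z) a
    refine measurable_of_tendsto_metrizable (fun n => hx n) (tendsto_pi_nhds.2 fun z => ?_)
    exact tendsto_const_nhds.inner hlim
  have htop : (⊤ : Submodule ℝ (L2 d)) ≤ s := by
    rw [← span_testFunctions_dense]
    refine Submodule.topologicalClosure_minimal _ (Submodule.span_le.2 ?_) hs
    rintro _ ⟨φ, hφ, hc, hm, rfl⟩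
    change Measurable fun z => inner ℝ (F z) (hm.toLp φ)
    have e : ∀ z, inner ℝ (F z) (hm.toLp φ)
        = (-1) ^ (∑ i, α i) * ∫ x, w x z * multiD α φ x := fun z => by
      rw [(hF z).2 φ hφ hc, ← mul_assoc, ← mul_pow, neg_one_mul, neg_neg, one_pow, one_mul,
        integral_mul_test _ hm]
    simp_rw [e]
    refine Measurable.const_mul (StronglyMeasurable.measurable ?_) _
    refine StronglyMeasurable.integral_prod_left (f := fun x z => w x z * multiD α φ x) ?_
    exact (hw.mul ((multiD_smooth α hφ).continuous.measurable.comp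
      measurable_fst)).stronglyMeasurable
  exact htop (Submodule.mem_top (x := y))

end Measurability

/-! ### Integration over the jump space -/

section Integration

variable {d m : ℕ} {K : ℝ} {Z : Type*} [MeasurableSpace Z] {μ : Measure Z}
  {c : 𝕍 d → Z → 𝕍 d} {cbar : Z → ℝ}

/-- For fixed `z` the constant `κ` is `min (cbar z) K`, which is at most `K` and at most
`cbar z`. -/
theorem JumpAssumption.jumpField (h : JumpAssumption μ m K c cbar) (z : Z) :
    JumpField m K (min (cbar z) K) fun x => c x z where
  contDiff := (h.contDiff z).of_le (by exact_mod_cast Nat.le_add_left 1 m)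
  le := min_le_right _ _
  norm_le x := by simpa [multiD_zero] using h.norm_multiD_le 0 (by simp) x z
  derivBound j := by
    refine derivBound_of_multiD ?_ fun α hα x => ?_
    · exact (EuclideanSpace.proj (𝕜 := ℝ) j : 𝕍 d →L[ℝ] ℝ).contDiff.comp (h.contDiff z)
    · rw [multiD_component α j ((h.contDiff z).of_le (by exact_mod_cast hα))]
      exact (abs_apply_le_norm _ j).trans (h.norm_multiD_le α hα x z)
  le_abs_det x θ hθ := h.le_abs_det x z θ hθ

end Integration

theorem mainTheorem2 (d m : ℕ) (hd : 1 ≤ d) (hm : 1 ≤ m) (K : ℝ) (hK : 0 < K) :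
    ∃ N : ℝ, ∀ (Z : Type*) [MeasurableSpace Z] (μ : Measure Z)
      (c : EuclideanSpace ℝ (Fin d) → Z → EuclideanSpace ℝ (Fin d)) (cbar : Z → ℝ),
      JumpAssumption μ m K c cbar →
      ∀ u : EuclideanSpace ℝ (Fin d) → ℝ, MemH (m + 2) u →
      ∀ α : Fin d → ℕ, ∑ i, α i ≤ m →
        JumpGWellDefined μ c α u ∧
        jumpG μ c α u ≤ N * (∫ z, cbar z ^ 2 ∂μ) * normH m u ^ 2 := by
  obtain ⟨N, hN0, hN⟩ := exists_pointwise_bound d m hm hK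
  refine ⟨N, fun Z _ μ c cbar hc u hu α hα => ?_⟩
  choose W L hW hL h1 h2 h3 using fun z => hN _ _ (hc.jumpField z) u hu α hα
  set v := weakDeriv α u
  have hv : IsWeakDeriv α u v := hu.isWeakDeriv (by omega)
  have hdiff : ∀ z, IsWeakDeriv α (jumpDiff c u z) (W z - v) := fun z => (hW z).sub hv
  have hrem : ∀ z, IsWeakDeriv α (jumpRem c u z) (W z - v - L z) :=
    fun z => (hdiff z).sub (hL z)
  have ediff : (fun z => weakDeriv α (jumpDiff c u z)) = fun z => W z - v :=
    funext fun z => (hdiff z).weakDeriv_eq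
  have erem : (fun z => weakDeriv α (jumpRem c u z)) = fun z => W z - v - L z :=
    funext fun z => (hrem z).weakDeriv_eq
  -- A Borel measurable representative of `u` makes the increments jointly measurable.
  let w : EuclideanSpace ℝ (Fin d) → ℝ := hu.1.toLp u
  have hwm : Measurable w := (Lp.stronglyMeasurable _).measurable
  have hwu : w =ᵐ[volume] u := hu.1.coeFn_toLp
  have hshift : ∀ z, (fun x => w (x + c x z)) =ᵐ[volume] fun x => u (x + c x z) :=
    fun z => ((hc.jumpField z).quasiMeasurePreserving hK).ae_eq_comp hwu
  have hwd : Measurable fun p : EuclideanSpace ℝ (Fin d) × Z => w (p.1 + c p.1 p.2) - w p.1 :=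
    (hwm.comp (measurable_fst.add hc.measurable)).sub (hwm.comp measurable_fst)
  have mdiff : StronglyMeasurable fun z => W z - v := by
    refine stronglyMeasurable_of_isWeakDeriv (α := α) (w := fun x z => w (x + c x z) - w x)
      hwd fun z => (hdiff z).congr ?_
    filter_upwards [hshift z, hwu] with x h4 h5
    rw [jumpDiff, h4, h5]
  have mrem : StronglyMeasurable fun z => W z - v - L z := by
    refine stronglyMeasurable_of_isWeakDeriv (α := α) (w := fun x z => w (x + c x z) - w x
      - ∑ i, c x z i * weakDeriv (Pi.single i 1) u x) ?_ fun z => (hrem z).congr ?_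
    · refine hwd.sub (Finset.measurable_fun_sum _ fun i _ => Measurable.mul ?_ ?_)
      · exact (EuclideanSpace.proj (𝕜 := ℝ) i : 𝕍 d →L[ℝ] ℝ).continuous.measurable.comp
          hc.measurable
      · exact (Lp.stronglyMeasurable _).measurable.comp measurable_fst
    · filter_upwards [hshift z, hwu] with x h4 h5
      rw [jumpRem, h4, h5]
  have hsq : Integrable (fun z => cbar z ^ 2) μ := hc.memLp_cbar.integrable_sq
  have hκ : ∀ z, min (cbar z) K ^ 2 ≤ cbar z ^ 2 := fun z =>
    pow_le_pow_left₀ (hc.jumpField z).nonneg (min_le_left _ _) 2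
  have hS : 0 ≤ normH (m + 2) u := Real.sqrt_nonneg _
  have idiff : Integrable (fun z => ‖W z - v‖ ^ 2) μ := by
    refine (hsq.const_mul ((N * normH (m + 2) u) ^ 2)).mono'
      (mdiff.norm.pow 2).aestronglyMeasurable (ae_of_all _ fun z => ?_)
    rw [Real.norm_of_nonneg (sq_nonneg _)]
    calc ‖W z - v‖ ^ 2 ≤ (N * normH (m + 2) u * min (cbar z) K) ^ 2 := by
          have := h1 z
          gcongr
      _ = (N * normH (m + 2) u) ^ 2 * min (cbar z) K ^ 2 := by ring
      _ ≤ _ := by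
          have := hκ z
          gcongr
  have irem : Integrable (fun z => W z - v - L z) μ := by
    refine (hsq.const_mul (N * normH (m + 2) u)).mono' mrem.aestronglyMeasurable
      (ae_of_all _ fun z => (h2 z).trans ?_)
    have := hκ z
    gcongr
  refine ⟨⟨fun z => ⟨_, hdiff z⟩, fun z => ⟨_, hrem z⟩, ?_, ?_⟩, ?_⟩
  · simp_rw [(hdiff _).weakDeriv_eq]; exact idiff
  · rw [erem]; exact irem
  · unfold jumpG
    rw [erem]
    simp_rw [(hdiff _).weakDeriv_eq]
    have e : inner ℝ (∫ z, (W z - v - L z) ∂μ) v = ∫ z, inner ℝ (W z - v - L z) v ∂μ := by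
      rw [real_inner_comm, ← integral_inner irem]
      simp_rw [real_inner_comm v]
    have hi : Integrable (fun z => inner ℝ (W z - v - L z) v) μ := irem.inner_const v
    change _ + 2 * inner ℝ _ v ≤ _
    rw [e, ← integral_const_mul, ← integral_add idiff (hi.const_mul 2)]
    calc _ ≤ ∫ z, N * normH m u ^ 2 * cbar z ^ 2 ∂μ := by
          refine integral_mono (idiff.add (hi.const_mul 2)) (hsq.const_mul _) fun z =>
            (h3 z).trans ?_
          have := hκ z
          gcongr
      _ = N * (∫ z, cbar z ^ 2 ∂μ) * normH m u ^ 2 := by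
          rw [integral_const_mul]; ring
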